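/- **Spherical Gauss–Lucas theorem.** Equip $\mathbb{CP}^1$ with the Fubini–Study metric, normalized to have diameter $\pi/2$, and $\mathcal O(n)$ with the Fubini–Study Hermitian metric and its Chern connection $\nabla$. Two points of $\mathbb{CP}^1$ are opposite if their distance is $\pi/2$, and an open hemisphere is an open ball of radius $\pi/4$. A critical point of a holomorphic section $s$ of $\mathcal O(n)$ is a point where $\nabla s=0$. Let $n\ge 2$ and let $s\in H^0(\mathbb{CP}^1,\mathcal O(n))$ be a nonzero section all of whose zeros lie in one open hemisphere. Let $P$ be the geodesic convex hull of the zeros (a geodesic segment if the zeros lie on one minimizing geodesic, a point if there is only one zero), and let $P_\infty$ be the set of the points opposite to the points of $P$. If $P$ or $P_\infty$ is a geodesic segment, its interior means the segment without its end points. Let $C_s$ be the set of critical points of $s$, $C_{s,P}=C_s\cap P$ and $C_{s,P_\infty}=C_s\cap P_\infty$. Then: 1. $C_s=C_{s,P}\cup C_{s,P_\infty}$. 2. $C_{s,P_\infty}$ is nonempty, and if $P$ is not a point, then $C_{s,P_\infty}$ is contained in the interior of $P_\infty$. 3. $C_{s,P_\infty}$ contains a point which is not a zero of $s$ and is a local maximum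 of $\log|s|^2$; if this critical point of $\log|s|^2$ is non-degenerate, it has Morse index $2$. 4. If all critical points of the function $|s|^2$ on $\mathbb{CP}^1$ are non-degenerate, then $C_{s,P}$ is nonempty and contained in the interior of $P$. -/

import Mathlib

noncomputable section

namespace SphericalGL

open scoped LinearAlgebra.Projectivization

/-- `ℂ²` with its standard Hermitian inner product. -/
abbrev C2 : Type := EuclideanSpace ℂ (Fin 2)

/-- The complex projective line `ℂℙ¹`. -/
abbrev CP1 : Type := ℙ ℂ C2

/-! ### Fubini–Study geometry of `ℂℙ¹` -/

/-- The Fubini–Study distance, normalized so that the diameter of `ℂℙ¹` is `π / 2`. -/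
def fsDist (p q : CP1) : ℝ :=
  Real.arccos (‖inner ℂ p.rep q.rep‖ / (‖p.rep‖ * ‖q.rep‖))

/-- The open hemisphere centred at `c`. -/
def openHemisphere (c : CP1) : Set CP1 := {p | fsDist c p < Real.pi / 4}

/-- The union of all minimizing geodesics from `p` to `q`: the points where the triangle
inequality is an equality.  It is the minimizing geodesic segment if `p` and `q` are not opposite,
and all of `ℂℙ¹` if they are. -/
def geodSegment (p q : CP1) : Set CP1 := {r | fsDist p r + fsDist r q = fsDist p q}

/-- Geodesic convexity: all minimizing geodesics between points of the set stay in the set. -/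
def GeodConvex (K : Set CP1) : Prop := ∀ p ∈ K, ∀ q ∈ K, geodSegment p q ⊆ K

/-- The geodesic convex hull: the intersection of all geodesically convex sets containing `S`. -/
def geodHull (S : Set CP1) : Set CP1 := ⋂₀ {K | S ⊆ K ∧ GeodConvex K}

/-- The opposite of a set: all points at distance `π / 2` from one of its points. -/
def opposite (S : Set CP1) : Set CP1 := {q | ∃ p ∈ S, fsDist p q = Real.pi / 2}

/-- The great circle with pole `c`. -/
def greatCircle (c : CP1) : Set CP1 := {p | fsDist c p = Real.pi / 4}

/-- The intersection of all great circles containing `S` (all of `ℂℙ¹` if there is none). -/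
def geodSpan (S : Set CP1) : Set CP1 := {r | ∀ c, S ⊆ greatCircle c → r ∈ greatCircle c}

/-- The interior of a geodesically convex set relative to its geodesic span: the topological
interior for a polygon, the segment without its end points for a geodesic segment. -/
def geodInterior (S : Set CP1) : Set CP1 :=
  {q | q ∈ S ∧ ∃ ε > 0, ∀ r ∈ geodSpan S, fsDist q r < ε → r ∈ S}

/-! ### Affine charts, critical points, Hessians -/

/-- The lifts of the two affine charts: `(1, z)` and `(z, 1)`. -/
def chartVec (i : Fin 2) (z : ℂ) : C2 := if i = 0 then !₂[1, z] else !₂[z, 1]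

theorem chartVec_ne_zero (i : Fin 2) (z : ℂ) : chartVec i z ≠ 0 := by
  intro h
  have h' := congrArg (fun v : C2 => v i) h
  fin_cases i <;> simp [chartVec] at h'

/-- The two affine charts `z ↦ [1 : z]` and `z ↦ [z : 1]`, as parametrizations. -/
def chart (i : Fin 2) (z : ℂ) : CP1 :=
  Projectivization.mk ℂ (chartVec i z) (chartVec_ne_zero i z)

/-- `p` is a critical point of the real function `u`. -/
def IsCriticalPt (u : CP1 → ℝ) (p : CP1) : Prop :=
  ∀ i z, chart i z = p → fderiv ℝ (fun w => u (chart i w)) z = 0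

/-- The (real) Hessian of `u` in the affine coordinate. -/
def hessian (u : CP1 → ℝ) (i : Fin 2) (z : ℂ) : ℂ →L[ℝ] ℂ →L[ℝ] ℝ :=
  fderiv ℝ (fun y => fderiv ℝ (fun w => u (chart i w)) y) z

/-- Non-degeneracy of the Hessian of `u` at a (critical) point `p`. -/
def IsNondegenerateAt (u : CP1 → ℝ) (p : CP1) : Prop :=
  ∀ i z, chart i z = p → ∀ v : ℂ, v ≠ 0 → ∃ w : ℂ, hessian u i z v w ≠ 0

/-- The Morse index of `u` at the (critical) point `p` is `k`: the largest dimension of a real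
subspace on which the Hessian is negative definite. -/
def HasMorseIndex (u : CP1 → ℝ) (p : CP1) (k : ℕ) : Prop :=
  ∀ i z, chart i z = p →
    IsGreatest {d : ℕ | ∃ W : Submodule ℝ ℂ, Module.finrank ℝ W = d ∧
      ∀ v ∈ W, v ≠ 0 → hessian u i z v v < 0} k

/-- `p` is a local maximum of `u`. -/
def IsLocalMaxAt (u : CP1 → ℝ) (p : CP1) : Prop :=
  ∃ ε > 0, ∀ q, fsDist p q < ε → u q ≤ u p

/-- The Wirtinger derivative `∂g/∂z`. -/
def wirtinger (g : ℂ → ℂ) (z : ℂ) : ℂ :=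
  (fderiv ℝ g z 1 - Complex.I * fderiv ℝ g z Complex.I) / 2

/-! ### Sections of `𝒪(n)` -/

/-- A holomorphic section of `𝒪(n)` on `ℂℙ¹`: a holomorphic function on `ℂ² ∖ {0}` that is
homogeneous of degree `n`.  (The value at `0` is irrelevant.) -/
structure HolSection (n : ℕ) where
  /-- the homogeneous function on `ℂ² ∖ {0}` -/
  toFun : C2 → ℂ
  holomorphic : DifferentiableOn ℂ toFun {0}ᶜ
  homogeneous : ∀ (c : ℂ) (v : C2), c ≠ 0 → v ≠ 0 → toFun (c • v) = c ^ n * toFun v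

namespace HolSection

variable {n : ℕ}

/-- `s` is not the zero section. -/
def IsNonzero (s : HolSection n) : Prop := ∃ v : C2, v ≠ 0 ∧ s.toFun v ≠ 0

/-- The set of zeros of `s`. -/
def zeros (s : HolSection n) : Set CP1 := {p | s.toFun p.rep = 0}

/-- The squared Fubini–Study norm `|s|²`. -/
def normSq (s : HolSection n) (p : CP1) : ℝ := ‖s.toFun p.rep‖ ^ 2 / ‖p.rep‖ ^ (2 * n)

/-- `log |s|²`. -/
def logNormSq (s : HolSection n) (p : CP1) : ℝ := Real.log (s.normSq p)

/-- The coefficient `f` of `s = f e`, where `e` is the standard frame over the `i`-th chart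
(`e = Z₀ⁿ` or `e = Z₁ⁿ`). -/
def coeff (s : HolSection n) (i : Fin 2) (z : ℂ) : ℂ := s.toFun (chartVec i z)

/-- The Fubini–Study potential `φ = n log (1 + |z|²)`; the standard frame satisfies
`|e|² = exp (-φ)`. -/
def potential (n : ℕ) (z : ℂ) : ℂ := ((n * Real.log (1 + ‖z‖ ^ 2) : ℝ) : ℂ)

/-- The Hermitian (Chern) connection of the Fubini–Study metric in the `i`-th chart: the
coefficient of `∇ₕ s = (df - f ∂φ)(h) ⊗ e` at `z`, for a tangent vector `h`. -/
def covDeriv (s : HolSection n) (i : Fin 2) (z h : ℂ) : ℂ :=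
  fderiv ℝ (s.coeff i) z h - s.coeff i z * (wirtinger (potential n) z * h)

/-- The critical points of `s`: the points where `∇ s` vanishes. -/
def criticalSet (s : HolSection n) : Set CP1 :=
  {p | ∀ i z, chart i z = p → ∀ h : ℂ, s.covDeriv i z h = 0}

/-- The geodesic convex hull of the zeros. -/
def hull (s : HolSection n) : Set CP1 := geodHull s.zeros

end HolSection

/-! ### Independence of representatives -/

theorem fsDist_mk (v w : C2) (hv : v ≠ 0) (hw : w ≠ 0) :
    fsDist (Projectivization.mk ℂ v hv) (Projectivization.mk ℂ w hw) =
      Real.arccos (‖inner ℂ v w‖ / (‖v‖ * ‖w‖)) := by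
  obtain ⟨a, ha⟩ := Projectivization.exists_smul_eq_mk_rep ℂ v hv
  obtain ⟨b, hb⟩ := Projectivization.exists_smul_eq_mk_rep ℂ w hw
  have ha0 : ‖(a : ℂ)‖ ≠ 0 := by simp
  have hb0 : ‖(b : ℂ)‖ ≠ 0 := by simp
  unfold fsDist
  rw [← ha, ← hb]
  simp only [Units.smul_def, inner_smul_left, inner_smul_right, norm_mul, norm_smul,
    RCLike.norm_conj]
  congr 1
  have hv0 : ‖v‖ ≠ 0 := by simpa using hv
  have hw0 : ‖w‖ ≠ 0 := by simpa using hw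
  field_simp

theorem HolSection.normSq_mk {n : ℕ} (s : HolSection n) (v : C2) (hv : v ≠ 0) :
    s.normSq (Projectivization.mk ℂ v hv) = ‖s.toFun v‖ ^ 2 / ‖v‖ ^ (2 * n) := by
  obtain ⟨a, ha⟩ := Projectivization.exists_smul_eq_mk_rep ℂ v hv
  have ha0 : ‖(a : ℂ)‖ ≠ 0 := by simp
  have hv0 : ‖v‖ ≠ 0 := by simpa using hv
  unfold HolSection.normSq
  rw [← ha, Units.smul_def, s.homogeneous _ _ a.ne_zero hv, norm_mul, norm_smul, norm_pow]
  field_simp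
  ring

end SphericalGL

end

noncomputable section

namespace SphericalGL

open scoped LinearAlgebra.Projectivization NNReal
open InnerProductGeometry

/-! The Bloch (Hopf) map identifies `ℂℙ¹` with the unit sphere of `ℝ³`, and `fsDist` becomes half
the angle. A nonzero section is a constant times a product of `n` linear forms `⟪b i, ·⟫`. The zero
of the `i`-th form is the antipode `p i` of the Bloch vector of `b i`, and `|s|²` is a positive
constant times `∏ i, (1 - ⟪x, p i⟫)`. Away from the zeros, `∇ s = 0` says that this product is
stationary on the sphere: the force `V x = ∑ i, (1 - ⟪x, p i⟫)⁻¹ • p i` is a multiple `a • x`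
(`Factors.covDeriv_eq_zero_iff`).

If all `p i` satisfy `0 < ⟪c, p i⟫`, then `⟪c, V x⟫ > 0`, so `a ≠ 0` and `x = a⁻¹ • V x` is a
strictly positive combination of the `p i` or of the `-p i` (`pos_combination_of_force_eq`). The
geodesic hull is the trace on the sphere of the convex cone of the `p i` (`mem_geodHull_iff`), and
strictly positive combinations are relative interior points. This locates the critical points;
critical zeros lie in `P` anyway. A maximum of `|s|²` cannot lie on the side of `c`, since
reflection in the plane `cᗮ` would increase every factor; hence it lies in `P_∞`
(`exists_max_prod`).

For part 4, a multiple zero has vanishing two-jet of `|s|²`, so non-degeneracy makes the zeros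
simple, and simple zeros are not critical. If `P` contained no critical point, the map `x ↦ V x / ‖V
x‖`, extended by fixing the zeros, would strictly decrease the product off the zeros. The connected
set `P` would then be covered by at least two disjoint open basins of attraction
(`subsingleton_of_descent`, `exists_equilibrium_mem_coneSpan`). -/

/-! ### The Bloch sphere -/

/-- Euclidean three-space, the home of the Bloch sphere. -/
abbrev R3 : Type := EuclideanSpace ℝ (Fin 3)

/-- The point of the unit sphere of `ℝ³` that corresponds to the line spanned by `v`. -/
def bloch (v : C2) : R3 :=
  (‖v‖ ^ 2)⁻¹ • !₂[(v 0).re ^ 2 + (v 0).im ^ 2 - (v 1).re ^ 2 - (v 1).im ^ 2,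
    2 * ((v 0).re * (v 1).re + (v 0).im * (v 1).im),
    2 * ((v 0).re * (v 1).im - (v 0).im * (v 1).re)]

theorem norm_sq_C2 (v : C2) :
    ‖v‖ ^ 2 = (v 0).re ^ 2 + (v 0).im ^ 2 + (v 1).re ^ 2 + (v 1).im ^ 2 := by
  rw [EuclideanSpace.norm_sq_eq, Fin.sum_univ_two, ← Complex.normSq_eq_norm_sq,
    ← Complex.normSq_eq_norm_sq, Complex.normSq_apply, Complex.normSq_apply]
  ring

theorem inner_C2 (v w : C2) :
    inner ℂ v w = w 0 * (starRingEnd ℂ) (v 0) + w 1 * (starRingEnd ℂ) (v 1) := by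
  simp [PiLp.inner_apply, Fin.sum_univ_two]

theorem inner_R3 (x y : R3) : inner ℝ x y = x 0 * y 0 + x 1 * y 1 + x 2 * y 2 := by
  simp [PiLp.inner_apply, Fin.sum_univ_three, mul_comm]

/-- The half-angle formula `1 + cos θ = 2 cos² (θ / 2)`, with `θ` the angle between the Bloch
vectors. All comparisons of Hermitian and Euclidean data go through it. -/
theorem one_add_inner_bloch {v w : C2} (hv : v ≠ 0) (hw : w ≠ 0) :
    1 + inner ℝ (bloch v) (bloch w) = 2 * (‖inner ℂ v w‖ ^ 2 / (‖v‖ ^ 2 * ‖w‖ ^ 2)) := by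
  have hv0 : ‖v‖ ^ 2 ≠ 0 := by simpa using hv
  have hw0 : ‖w‖ ^ 2 ≠ 0 := by simpa using hw
  simp only [bloch, inner_smul_left, inner_smul_right, inner_R3]
  rw [← Complex.normSq_eq_norm_sq, inner_C2, Complex.normSq_apply]
  simp
  field_simp
  rw [norm_sq_C2, norm_sq_C2]
  ring

theorem norm_bloch {v : C2} (hv : v ≠ 0) : ‖bloch v‖ = 1 := by
  have h := one_add_inner_bloch hv hv
  have hv0 : ‖v‖ ≠ 0 := by simpa using hv
  rw [real_inner_self_eq_norm_sq, inner_self_eq_norm_sq_to_K] at h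
  have h2 : ‖bloch v‖ ^ 2 = 1 := by
    have : ‖((‖v‖ : ℂ)) ^ 2‖ = ‖v‖ ^ 2 := by simp
    erw [this] at h
    field_simp at h
    linarith
  nlinarith [norm_nonneg (bloch v)]

theorem bloch_surjective {x : R3} (hx : ‖x‖ = 1) : ∃ v : C2, v ≠ 0 ∧ bloch v = x := by
  have h1 : x 0 ^ 2 + x 1 ^ 2 + x 2 ^ 2 = 1 := by
    have := EuclideanSpace.norm_sq_eq x
    rw [hx, Fin.sum_univ_three] at this
    simpa using this.symm
  by_cases h : x 0 = -1
  · refine ⟨!₂[0, 1], fun h0 => ?_, ?_⟩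
    · simpa using congrArg (fun v : C2 => v 1) h0
    · have h2 : x 1 = 0 := by nlinarith
      have h3 : x 2 = 0 := by nlinarith
      ext k
      fin_cases k <;> simp [bloch, norm_sq_C2, h, h2, h3]
  · have hne : 1 + x 0 ≠ 0 := fun h0 => h (by linarith)
    -- A section of the Hopf map over the complement of the pole `x 0 = -1`; its squared norm is `2
    -- * (1 + x 0)`.
    refine ⟨!₂[((1 + x 0 : ℝ) : ℂ), ⟨x 1, x 2⟩], fun h0 => ?_, ?_⟩
    · have := congrArg (fun v : C2 => v 0) h0
      simp only [Matrix.cons_val_zero, PiLp.zero_apply] at this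
      exact hne (Complex.ofReal_eq_zero.1 this)
    · have hn : ‖(!₂[((1 + x 0 : ℝ) : ℂ), ⟨x 1, x 2⟩] : C2)‖ ^ 2 = 2 * (1 + x 0) := by
        rw [norm_sq_C2]; simp; linarith
      ext k
      rw [bloch, hn]
      fin_cases k <;> simp <;> field_simp
      linarith

/-- The identification of `ℂℙ¹` with the unit sphere. -/
def pt (p : CP1) : R3 := bloch p.rep

theorem norm_pt (p : CP1) : ‖pt p‖ = 1 := norm_bloch p.rep_nonzero

theorem pt_ne_zero (p : CP1) : pt p ≠ 0 := by
  intro h; simpa [h] using norm_pt p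

theorem bloch_smul {c : ℂ} (hc : c ≠ 0) (v : C2) : bloch (c • v) = bloch v := by
  have h : ‖c‖ ^ 2 ≠ 0 := by simpa using hc
  have h2 : c.re ^ 2 + c.im ^ 2 = ‖c‖ ^ 2 := by
    rw [← Complex.normSq_eq_norm_sq, Complex.normSq_apply]; ring
  by_cases hv : v = 0
  · simp [hv]
  have hv0 : ‖v‖ ^ 2 ≠ 0 := by simpa using hv
  ext k
  fin_cases k <;> simp [bloch, norm_smul, mul_pow] <;> field_simp <;> rw [← h2] <;> ring

theorem pt_mk (v : C2) (hv : v ≠ 0) : pt (Projectivization.mk ℂ v hv) = bloch v := by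
  obtain ⟨a, ha⟩ := Projectivization.exists_smul_eq_mk_rep ℂ v hv
  rw [pt, ← ha, Units.smul_def, bloch_smul a.ne_zero]

theorem pt_surjective {x : R3} (hx : ‖x‖ = 1) : ∃ p, pt p = x := by
  obtain ⟨v, hv, rfl⟩ := bloch_surjective hx
  exact ⟨_, pt_mk v hv⟩

theorem fsDist_eq_angle (p q : CP1) : fsDist p q = angle (pt p) (pt q) / 2 := by
  set t := ‖inner ℂ p.rep q.rep‖ / (‖p.rep‖ * ‖q.rep‖) with ht
  have ht0 : 0 ≤ t := by positivity
  have h := one_add_inner_bloch p.rep_nonzero q.rep_nonzero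
  have hi : inner ℝ (pt p) (pt q) = 2 * t ^ 2 - 1 := by
    rw [ht, div_pow, mul_pow, pt, pt]; linarith
  have ht1 : t ≤ 1 := by
    have := real_inner_le_norm (pt p) (pt q)
    rw [norm_pt, norm_pt, hi] at this
    nlinarith
  have h0 := Real.arccos_nonneg t
  have h1 : Real.arccos t ≤ Real.pi / 2 := Real.arccos_le_pi_div_two.2 ht0
  rw [angle, norm_pt, norm_pt, hi, fsDist]
  have : Real.cos (2 * Real.arccos t) = (2 * t ^ 2 - 1) / (1 * 1) := by
    rw [Real.cos_two_mul, Real.cos_arccos (by linarith) ht1]; ring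
  rw [← this, Real.arccos_cos (by linarith) (by linarith)]
  ring

theorem mem_openHemisphere_iff {c p : CP1} :
    p ∈ openHemisphere c ↔ 0 < inner ℝ (pt c) (pt p) := by
  rw [openHemisphere, Set.mem_ofPred_eq, fsDist_eq_angle, ← Real.arccos_lt_pi_div_two,
    angle, norm_pt, norm_pt, mul_one, div_one]
  constructor <;> intro h <;> linarith

theorem mem_greatCircle_iff {c p : CP1} : p ∈ greatCircle c ↔ inner ℝ (pt c) (pt p) = 0 := by
  rw [greatCircle, Set.mem_ofPred_eq, fsDist_eq_angle, inner_eq_zero_iff_angle_eq_pi_div_two]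
  constructor <;> intro h <;> linarith

theorem mem_opposite_iff {S : Set CP1} {q : CP1} :
    q ∈ opposite S ↔ ∃ p ∈ S, pt q = -pt p := by
  have key (p : CP1) : fsDist p q = Real.pi / 2 ↔ pt q = -pt p := by
    rw [fsDist_eq_angle, div_left_inj' two_ne_zero,
      ← inner_eq_neg_mul_norm_iff_angle_eq_pi (pt_ne_zero _) (pt_ne_zero _), norm_pt, norm_pt,
      mul_one, ← neg_eq_iff_eq_neg (b := (1 : ℝ)), ← inner_neg_left,
      inner_eq_one_iff_of_norm_eq_one (by simp [norm_pt]) (norm_pt q)]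
    exact eq_comm
  simp only [opposite, Set.mem_ofPred_eq, key]

/-- A chord is no longer than its arc. This turns `fsDist`-balls into Euclidean ones. -/
theorem norm_pt_sub_le (p q : CP1) : ‖pt p - pt q‖ ≤ 2 * fsDist p q := by
  have h := Real.one_sub_sq_div_two_le_cos (x := angle (pt p) (pt q))
  rw [← inner_eq_cos_angle_of_norm_eq_one (norm_pt p) (norm_pt q)] at h
  have h2 := norm_sub_sq_real (pt p) (pt q)
  rw [norm_pt, norm_pt] at h2
  rw [fsDist_eq_angle]
  apply le_of_sq_le_sq _ (by linarith [angle_nonneg (pt p) (pt q)])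
  nlinarith

/-! ### Geodesic convexity and convex cones -/

/-- The convex cone generated by a family of vectors. -/
abbrev coneSpan {ι : Type*} (p : ι → R3) : Submodule ℝ≥0 R3 :=
  Submodule.span ℝ≥0 (Set.range p)

/-- This is the equality case of the triangle inequality for angles; between antipodes every point
qualifies. -/
theorem mem_geodSegment_iff {p q r : CP1} :
    r ∈ geodSegment p q ↔
      angle (pt p) (pt q) = Real.pi ∨ pt r ∈ Submodule.span ℝ≥0 {pt p, pt q} := by
  rw [← angle_eq_angle_add_angle_iff (pt_ne_zero r), geodSegment, Set.mem_ofPred_eq,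
    fsDist_eq_angle, fsDist_eq_angle, fsDist_eq_angle]
  constructor <;> intro h <;> linarith

theorem mem_coneSpan_iff {ι : Type*} [Fintype ι] {p : ι → R3} {x : R3} :
    x ∈ coneSpan p ↔ ∃ t : ι → ℝ, (∀ i, 0 ≤ t i) ∧ ∑ i, t i • p i = x := by
  rw [coneSpan, Submodule.mem_span_range_iff_exists_fun]
  constructor
  · rintro ⟨t, ht⟩
    exact ⟨fun i => t i, fun i => (t i).2, ht⟩
  · rintro ⟨t, ht, h⟩
    exact ⟨fun i => ⟨t i, ht i⟩, h⟩

theorem inner_pos_of_mem_coneSpan {ι : Type*} [Fintype ι] {p : ι → R3} {c x : R3}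
    (hc : ∀ i, 0 < inner ℝ c (p i)) (hx : x ∈ coneSpan p) (hx0 : x ≠ 0) :
    0 < inner ℝ c x := by
  obtain ⟨t, ht, rfl⟩ := mem_coneSpan_iff.1 hx
  simp only [inner_sum, inner_smul_right]
  have h0 : ∀ i ∈ Finset.univ, 0 ≤ t i * inner ℝ c (p i) := fun i _ =>
    mul_nonneg (ht i) (hc i).le
  refine lt_of_le_of_ne (Finset.sum_nonneg h0) fun h => hx0 ?_
  refine Finset.sum_eq_zero fun i hi => ?_
  have := (Finset.sum_eq_zero_iff_of_nonneg h0).1 h.symm i hi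
  rw [(mul_eq_zero.1 this).resolve_right (hc i).ne', zero_smul]

theorem smul_mem_coneSpan {ι : Type*} {p : ι → R3} {a : ℝ} (ha : 0 ≤ a) {x : R3}
    (hx : x ∈ coneSpan p) : a • x ∈ coneSpan p :=
  (coneSpan p).smul_mem ⟨a, ha⟩ hx

/-- The direction of a sum of two nonzero vectors lies on the geodesic between their directions, so
induction over the cone never leaves `K`. The rescaling `r` is there because the vectors met in the
induction are not unit vectors; for the zero vector the claim is vacuous. -/
theorem mem_of_geodConvex {ι : Type*} {p : ι → R3} {Z K : Set CP1}
    (hp : ∀ i, ‖p i‖ = 1) (hZ : ∀ q i, pt q = p i → q ∈ Z) (hZK : Z ⊆ K)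
    (hK : GeodConvex K) {y : R3} (hy : y ∈ coneSpan p) :
    ∀ (q : CP1) (r : ℝ), 0 < r → y = r • pt q → q ∈ K := by
  have ray (y : R3) (hy0 : y ≠ 0) : ∃ q : CP1, ∃ r : ℝ, 0 < r ∧ y = r • pt q := by
    obtain ⟨q, hq⟩ := pt_surjective (x := ‖y‖⁻¹ • y) (norm_smul_inv_norm hy0)
    exact ⟨q, ‖y‖, norm_pos_iff.2 hy0, by rw [hq, smul_inv_smul₀ (norm_ne_zero_iff.2 hy0)]⟩
  induction hy using Submodule.span_induction with
  | mem y hy =>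
    obtain ⟨i, rfl⟩ := hy
    intro q r hr h
    have h1 : r = 1 := by
      have := congrArg norm h
      rw [hp, norm_smul, norm_pt, mul_one, Real.norm_of_nonneg hr.le] at this
      exact this.symm
    rw [h1, one_smul] at h
    exact hZK (hZ q i h.symm)
  | zero =>
    intro q r hr h
    exact absurd h.symm (smul_ne_zero hr.ne' (pt_ne_zero q))
  | add y₁ y₂ _ _ h₁ h₂ =>
    intro q r hr h
    by_cases hy₁ : y₁ = 0
    · exact h₂ q r hr (by rw [← h, hy₁, zero_add])
    by_cases hy₂ : y₂ = 0
    · exact h₁ q r hr (by rw [← h, hy₂, add_zero])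
    obtain ⟨q₁, r₁, hr₁, e₁⟩ := ray y₁ hy₁
    obtain ⟨q₂, r₂, hr₂, e₂⟩ := ray y₂ hy₂
    refine hK q₁ (h₁ q₁ r₁ hr₁ e₁) q₂ (h₂ q₂ r₂ hr₂ e₂) (mem_geodSegment_iff.2 (Or.inr ?_))
    rw [Submodule.mem_span_pair]
    refine ⟨⟨r₁ / r, by positivity⟩, ⟨r₂ / r, by positivity⟩, ?_⟩
    change (r₁ / r) • pt q₁ + (r₂ / r) • pt q₂ = pt q
    rw [div_eq_inv_mul, div_eq_inv_mul, mul_smul, mul_smul, ← e₁, ← e₂, ← smul_add, h,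
      inv_smul_smul₀ hr.ne']
  | smul a y _ h =>
    intro q r hr e
    have ha : 0 < (a : ℝ) := by
      refine lt_of_le_of_ne a.2 fun h0 => smul_ne_zero hr.ne' (pt_ne_zero q) ?_
      rw [← e, NNReal.smul_def, ← h0, zero_smul]
    refine h q ((a : ℝ)⁻¹ * r) (by positivity) ?_
    rw [mul_smul, ← e, NNReal.smul_def, inv_smul_smul₀ ha.ne']

/-- Since the cone lies strictly on the side of `c`, it contains no antipodal directions, so its
trace on the sphere is itself geodesically convex. -/
theorem mem_geodHull_iff {ι : Type*} [Fintype ι] {p : ι → R3} {c : R3} {Z : Set CP1}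
    (hp : ∀ i, ‖p i‖ = 1) (hc : ∀ i, 0 < inner ℝ c (p i)) (hZ : ∀ q, q ∈ Z ↔ ∃ i, pt q = p i)
    {q : CP1} : q ∈ geodHull Z ↔ pt q ∈ coneSpan p := by
  constructor
  · intro h
    refine h {q | pt q ∈ coneSpan p} ⟨fun z hz => ?_, fun a ha b hb r hr => ?_⟩
    · obtain ⟨i, hi⟩ := (hZ z).1 hz
      change pt z ∈ coneSpan p
      rw [hi]
      exact Submodule.subset_span ⟨i, rfl⟩
    · have pa := inner_pos_of_mem_coneSpan hc ha (pt_ne_zero a)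
      have pb := inner_pos_of_mem_coneSpan hc hb (pt_ne_zero b)
      rcases mem_geodSegment_iff.1 hr with h | h
      · exfalso
        obtain ⟨_, u, hu, e⟩ := angle_eq_pi_iff.1 h
        rw [e, inner_smul_right] at pb
        nlinarith
      · change pt r ∈ coneSpan p
        refine Submodule.span_le.2 ?_ h
        rintro x (rfl | rfl)
        · exact ha
        · exact hb
  · intro h K hK
    exact mem_of_geodConvex hp (fun q i hq => (hZ q).2 ⟨i, hq⟩) hK.1 hK.2 h q 1 one_pos
      (one_smul _ _).symm

theorem coneSpan_neg {ι : Type*} [Fintype ι] {p : ι → R3} {x : R3} :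
    x ∈ coneSpan (-p) ↔ -x ∈ coneSpan p := by
  rw [mem_coneSpan_iff, mem_coneSpan_iff]
  simp [neg_eq_iff_eq_neg]

theorem mem_opposite_coneSpan {ι : Type*} [Fintype ι] {p : ι → R3} {S : Set CP1}
    (hS : ∀ q, q ∈ S ↔ pt q ∈ coneSpan p) {q : CP1} :
    q ∈ opposite S ↔ pt q ∈ coneSpan (-p) := by
  rw [mem_opposite_iff, coneSpan_neg]
  constructor
  · rintro ⟨r, hr, h⟩
    rw [h, neg_neg]
    exact (hS r).1 hr
  · intro h
    obtain ⟨r, hr⟩ := pt_surjective (x := -pt q) (by rw [norm_neg, norm_pt])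
    exact ⟨r, (hS r).2 (hr ▸ h), by rw [hr, neg_neg]⟩

/-- Great circles are the traces of planes `dᗮ`, so the claim is the double orthogonal complement of
the span. -/
theorem mem_span_of_mem_geodSpan {ι : Type*} [Fintype ι] {p : ι → R3} {S : Set CP1}
    (hS : ∀ q, q ∈ S ↔ pt q ∈ coneSpan p) {r : CP1} (hr : r ∈ geodSpan S) :
    pt r ∈ Submodule.span ℝ (Set.range p) := by
  rw [← Submodule.orthogonal_orthogonal (Submodule.span ℝ (Set.range p)),
    Submodule.mem_orthogonal]
  intro d hd
  by_cases hd0 : d = 0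
  · simp [hd0]
  obtain ⟨c, hc⟩ := pt_surjective (x := ‖d‖⁻¹ • d) (norm_smul_inv_norm hd0)
  have hSc : S ⊆ greatCircle c := by
    intro q hq
    rw [mem_greatCircle_iff, hc, inner_smul_left]
    obtain ⟨t, -, h⟩ := mem_coneSpan_iff.1 ((hS q).1 hq)
    have : inner ℝ d (pt q) = 0 := by
      refine Submodule.inner_left_of_mem_orthogonal ?_ hd
      rw [← h]
      exact Submodule.sum_mem _ fun i _ =>
        Submodule.smul_mem _ _ (Submodule.subset_span ⟨i, rfl⟩)
    rw [this, mul_zero]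
  have := mem_greatCircle_iff.1 (hr c hSc)
  rw [hc, inner_smul_left] at this
  exact (mul_eq_zero.1 this).resolve_left (by simpa using hd0)

/-- A strictly positive combination of the generators is a relative interior point of their
cone. -/
theorem exists_ball_inter_span_subset_coneSpan {ι : Type*} [Fintype ι] {p : ι → R3} {t : ι → ℝ}
    (ht : ∀ i, 0 < t i) :
    ∃ ε > 0, ∀ y ∈ Submodule.span ℝ (Set.range p), ‖(∑ i, t i • p i) - y‖ < ε →
      y ∈ coneSpan p := by
  classical
  let T : (ι → ℝ) →ₗ[ℝ] R3 := Fintype.linearCombination ℝ p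
  have hT (u : ι → ℝ) : T u = ∑ i, u i • p i := Fintype.linearCombination_apply ℝ p u
  have hrange : LinearMap.range T = Submodule.span ℝ (Set.range p) :=
    Fintype.range_linearCombination ℝ p
  -- A linear map is open onto its finite-dimensional range, so the open positive orthant has
  -- relatively open image.
  have hopen : IsOpenMap T.rangeRestrict :=
    T.rangeRestrict.isOpenMap_of_finiteDimensional T.surjective_rangeRestrict
  have hU : IsOpen (Set.univ.pi fun _ : ι => Set.Ioi (0 : ℝ)) :=
    isOpen_set_pi Set.finite_univ fun _ _ => isOpen_Ioi
  obtain ⟨ε, hε, h⟩ := Metric.isOpen_iff.1 (hopen _ hU) (T.rangeRestrict t)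
    ⟨t, fun i _ => ht i, rfl⟩
  refine ⟨ε, hε, fun y hy hlt => ?_⟩
  rw [← hrange] at hy
  obtain ⟨u, hu, e⟩ := @h ⟨y, hy⟩ (by
    rw [Metric.mem_ball, dist_comm, Subtype.dist_eq, dist_eq_norm]
    simpa [hT] using hlt)
  refine mem_coneSpan_iff.2 ⟨u, fun i => (hu i trivial).le, ?_⟩
  rw [← hT]
  exact congrArg Subtype.val e

theorem mem_geodInterior {ι : Type*} [Fintype ι] {p : ι → R3} {S : Set CP1}
    (hS : ∀ q, q ∈ S ↔ pt q ∈ coneSpan p) {q : CP1} {t : ι → ℝ} (ht : ∀ i, 0 < t i)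
    (hq : pt q = ∑ i, t i • p i) : q ∈ geodInterior S := by
  refine ⟨(hS q).2 (mem_coneSpan_iff.2 ⟨t, fun i => (ht i).le, hq.symm⟩), ?_⟩
  obtain ⟨ε, hε, h⟩ := exists_ball_inter_span_subset_coneSpan (p := p) ht
  refine ⟨ε / 2, by positivity, fun r hr hd => (hS r).2 (h _ (mem_span_of_mem_geodSpan hS hr) ?_)⟩
  rw [← hq]
  linarith [norm_pt_sub_le q r]

/-! ### Factorization of sections -/

/-- An entire function of growth at most `|z| ^ n` is a polynomial of degree at most `n`. -/
theorem exists_polynomial_of_growth {f : ℂ → ℂ} (hf : Differentiable ℂ f) {n : ℕ} {C : ℝ}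
    (hC : ∀ z : ℂ, 1 ≤ ‖z‖ → ‖f z‖ ≤ C * ‖z‖ ^ n) :
    ∃ q : Polynomial ℂ, q.natDegree ≤ n ∧ ∀ z, f z = q.eval z := by
  -- Cauchy estimates on the circles `‖z‖ = R`, as `R → ∞`.
  have hder (k : ℕ) (hk : n < k) : iteratedDeriv k f 0 = 0 := by
    have hb : ∀ R : ℝ, 1 ≤ R → ‖iteratedDeriv k f 0‖ ≤ k.factorial * C * R⁻¹ := by
      intro R hR
      have hR0 : 0 < R := by linarith
      have hC0 : 0 ≤ C := by
        have := hC 1 (by simp)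
        simp only [norm_one, one_pow, mul_one] at this
        exact (norm_nonneg _).trans this
      have h := Complex.norm_iteratedDeriv_le_of_forall_mem_sphere_norm_le (c := 0) (R := R)
        (C := C * R ^ n) k hR0 hf.diffContOnCl (fun z hz => by
          have hz' : ‖z‖ = R := by simpa using hz
          have := hC z (by rw [hz']; exact hR)
          rwa [hz'] at this)
      refine h.trans ?_
      rw [mul_assoc, mul_div_assoc, mul_div_assoc]
      have h1 : R ^ n / R ^ k ≤ R⁻¹ := by
        obtain ⟨m, rfl⟩ := Nat.exists_eq_add_of_lt hk
        rw [div_le_iff₀ (by positivity), pow_succ, pow_add]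
        have : 1 ≤ R ^ m := one_le_pow₀ hR
        have h3 : R⁻¹ * (R ^ n * R ^ m * R) = R ^ n * R ^ m := by field_simp
        rw [h3]
        exact le_mul_of_one_le_right (by positivity) this
      gcongr
    have hlim : Filter.Tendsto (fun R : ℝ => k.factorial * C * R⁻¹) Filter.atTop
        (nhds (k.factorial * C * 0)) := tendsto_inv_atTop_zero.const_mul _
    rw [mul_zero] at hlim
    have := ge_of_tendsto hlim ((Filter.eventually_ge_atTop 1).mono hb)
    simpa using this
  refine ⟨∑ k ∈ Finset.range (n + 1),
    Polynomial.monomial k ((k.factorial : ℂ)⁻¹ * iteratedDeriv k f 0), ?_, fun z => ?_⟩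
  · refine Polynomial.natDegree_sum_le_of_forall_le _ _ fun k hk => ?_
    exact (Polynomial.natDegree_monomial_le _).trans (Nat.lt_succ_iff.1 (Finset.mem_range.1 hk))
  · rw [← Complex.taylorSeries_eq_of_entire' 0 z hf, tsum_eq_sum (s := Finset.range (n + 1)),
      Polynomial.eval_finsetSum]
    · simp
    · intro k hk
      rw [hder k (by simpa [Nat.lt_succ_iff] using hk)]
      simp

/-- A nonzero linear form on `ℂ²` is the inner product with a nonzero vector. -/
theorem exists_inner_eq (a b : ℂ) (h : a ≠ 0 ∨ b ≠ 0) :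
    ∃ u : C2, u ≠ 0 ∧ ∀ v : C2, inner ℂ u v = a * v 0 + b * v 1 := by
  refine ⟨!₂[(starRingEnd ℂ) a, (starRingEnd ℂ) b], fun h0 => ?_, fun v => ?_⟩
  · have h1 := congrArg (fun v : C2 => v 0) h0
    have h2 := congrArg (fun v : C2 => v 1) h0
    simp at h1 h2
    exact h.elim (fun h => h h1) (fun h => h h2)
  · rw [inner_C2]
    simp [mul_comm]

/-- Homogenization: the missing degree `n - l.length` becomes the power of `v 0`, the zeros at `[0 :
1]`. -/
theorem exists_inner_family (l : List ℂ) (n : ℕ) (hl : l.length ≤ n) :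
    ∃ b : Fin n → C2, (∀ i, b i ≠ 0) ∧ ∀ v : C2,
      ∏ i, inner ℂ (b i) v = v 0 ^ (n - l.length) * (l.map fun r => v 1 - r * v 0).prod := by
  induction n generalizing l with
  | zero =>
    obtain rfl : l = [] := List.eq_nil_of_length_eq_zero (Nat.le_zero.1 hl)
    exact ⟨Fin.elim0, fun i => i.elim0, fun v => by simp⟩
  | succ n ih =>
    cases l with
    | nil =>
      obtain ⟨b, hb, h⟩ := ih [] (by simp)
      obtain ⟨u, hu, e⟩ := exists_inner_eq 1 0 (Or.inl one_ne_zero)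
      refine ⟨Fin.cons u b, Fin.cases hu hb, fun v => ?_⟩
      rw [Fin.prod_univ_succ]
      simp [h, e, pow_succ, mul_comm]
    | cons r l =>
      obtain ⟨b, hb, h⟩ := ih l (by simpa using hl)
      obtain ⟨u, hu, e⟩ := exists_inner_eq (-r) 1 (Or.inr one_ne_zero)
      refine ⟨Fin.cons u b, Fin.cases hu hb, fun v => ?_⟩
      rw [Fin.prod_univ_succ]
      simp [h, e]
      ring

namespace HolSection

variable {n : ℕ}

theorem differentiable_chartVec (i : Fin 2) : Differentiable ℂ (chartVec i) := by
  rw [differentiable_euclidean]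
  intro k
  fin_cases i <;> fin_cases k <;> simp [chartVec]

theorem differentiable_coeff (s : HolSection n) (i : Fin 2) : Differentiable ℂ (s.coeff i) := by
  intro z
  have h : DifferentiableAt ℂ s.toFun (chartVec i z) :=
    s.holomorphic.differentiableAt (isOpen_compl_singleton.mem_nhds (chartVec_ne_zero i z))
  exact h.comp z (differentiable_chartVec i z)

theorem toFun_of_ne_zero (s : HolSection n) {v : C2} (hv : v 0 ≠ 0) :
    s.toFun v = v 0 ^ n * s.coeff 0 (v 1 / v 0) := by
  rw [coeff, ← s.homogeneous _ _ hv (chartVec_ne_zero _ _)]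
  congr 1
  ext k
  fin_cases k <;> simp [chartVec]
  field_simp

theorem coeff_growth (s : HolSection n) :
    ∃ C : ℝ, ∀ z : ℂ, 1 ≤ ‖z‖ → ‖s.coeff 0 z‖ ≤ C * ‖z‖ ^ n := by
  obtain ⟨C, hC⟩ := (isCompact_closedBall (0 : ℂ) 1).exists_bound_of_continuousOn
    (s.differentiable_coeff 1).continuous.continuousOn
  refine ⟨C, fun z hz => ?_⟩
  have hz0 : z ≠ 0 := by rintro rfl; norm_num at hz
  have h : s.coeff 0 z = z ^ n * s.coeff 1 z⁻¹ := by
    rw [coeff, coeff, ← s.homogeneous _ _ hz0 (chartVec_ne_zero _ _)]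
    congr 1
    ext k
    fin_cases k <;> simp [chartVec, hz0]
  rw [h, norm_mul, norm_pow, mul_comm]
  gcongr
  exact hC _ (by simpa using inv_le_one_of_one_le₀ hz)

/-- A nonzero section is a product of linear forms. -/
theorem exists_factorization (s : HolSection n) (hs : s.IsNonzero) :
    ∃ (C : ℂ) (b : Fin n → C2), C ≠ 0 ∧ (∀ i, b i ≠ 0) ∧
      ∀ v : C2, v ≠ 0 → s.toFun v = C * ∏ i, inner ℂ (b i) v := by
  obtain ⟨A, hA⟩ := s.coeff_growth
  obtain ⟨q, hq, hfq⟩ := exists_polynomial_of_growth (s.differentiable_coeff 0) hA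
  have hcard : q.roots.toList.length = q.natDegree := by
    rw [Multiset.length_toList]
    exact ((IsAlgClosed.splits q).natDegree_eq_card_roots).symm
  obtain ⟨b, hb, hprod⟩ := exists_inner_family q.roots.toList n (by rw [hcard]; exact hq)
  have heval (z : ℂ) : q.eval z = q.leadingCoeff * (q.roots.toList.map fun r => z - r).prod := by
    conv_lhs => rw [(IsAlgClosed.splits q).eq_prod_roots]
    rw [Polynomial.eval_mul, Polynomial.eval_C, Polynomial.eval_multiset_prod, Multiset.map_map]
    conv_lhs => rw [← Multiset.coe_toList q.roots]
    simp
  have hgen (v : C2) (hv : v 0 ≠ 0) : s.toFun v = q.leadingCoeff * ∏ i, inner ℂ (b i) v := by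
    have hl (l : List ℂ) : v 0 ^ l.length * (l.map fun r => v 1 / v 0 - r).prod =
        (l.map fun r => v 1 - r * v 0).prod := by
      induction l with
      | nil => simp
      | cons r l ih =>
        rw [List.map_cons, List.prod_cons, List.map_cons, List.prod_cons, ← ih, List.length_cons,
          pow_succ]
        have : v 0 * (v 1 / v 0 - r) = v 1 - r * v 0 := by field_simp
        rw [← this]
        ring
    rw [s.toFun_of_ne_zero hv, hfq, heval, hprod, ← hl, ← mul_assoc (v 0 ^ (n - _)), ← pow_add,
      Nat.sub_add_cancel (by rw [hcard]; exact hq)]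
    ring
  have hall (v : C2) (hv : v ≠ 0) : s.toFun v = q.leadingCoeff * ∏ i, inner ℂ (b i) v := by
    by_cases hv0 : v 0 = 0
    -- The line `v 0 = 0` is missed by the chart; the identity extends to it by continuity along
    -- `γ`.
    · let γ : ℂ → C2 := fun z => v + z • !₂[1, 0]
      have hγ : Continuous γ := by fun_prop
      have hγ0 : γ 0 = v := by simp [γ]
      have h1 : Filter.Tendsto (fun z => s.toFun (γ z)) (nhdsWithin 0 {0}ᶜ)
          (nhds (s.toFun v)) := by
        have hc : ContinuousAt s.toFun (γ 0) := by
          rw [hγ0]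
          exact (s.holomorphic.differentiableAt
            (isOpen_compl_singleton.mem_nhds hv)).continuousAt
        have := (hc.comp hγ.continuousAt).tendsto
        simp only [Function.comp_def, hγ0] at this
        exact this.mono_left nhdsWithin_le_nhds
      have h2 : Filter.Tendsto (fun z => q.leadingCoeff * ∏ i, inner ℂ (b i) (γ z))
          (nhdsWithin 0 {0}ᶜ) (nhds (q.leadingCoeff * ∏ i, inner ℂ (b i) v)) := by
        have hc : Continuous fun z => q.leadingCoeff * ∏ i, inner ℂ (b i) (γ z) := by fun_prop
        have := hc.tendsto 0
        rw [hγ0] at this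
        exact this.mono_left nhdsWithin_le_nhds
      refine tendsto_nhds_unique h1 (h2.congr' ?_)
      filter_upwards [self_mem_nhdsWithin] with z hz
      exact (hgen _ (by simpa [γ, hv0] using hz)).symm
    · exact hgen v hv0
  refine ⟨q.leadingCoeff, b, ?_, hb, hall⟩
  intro h0
  obtain ⟨v, hv, hne⟩ := hs
  exact hne (by rw [hall v hv, h0, zero_mul])

end HolSection

/-! ### The critical point equation -/

/-- The vector orthogonal to `v`. -/
def perp (v : C2) : C2 := !₂[-(starRingEnd ℂ) (v 1), (starRingEnd ℂ) (v 0)]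

/-- The projection of `ℝ³` to the tangent plane of the sphere at `bloch v`, the plane being
identified with `ℂ` up to a factor. -/
def tangentMap (v : C2) : R3 →ₗ[ℝ] ℂ where
  toFun y := y 0 * (-2 * (starRingEnd ℂ) (v 0) * (starRingEnd ℂ) (v 1)) +
    y 1 * ((starRingEnd ℂ) (v 0) ^ 2 - (starRingEnd ℂ) (v 1) ^ 2) -
    y 2 * (Complex.I * ((starRingEnd ℂ) (v 0) ^ 2 + (starRingEnd ℂ) (v 1) ^ 2))
  map_add' x y := by simp; ring
  map_smul' a y := by simp; ring

/-- `tangentMap v y` is the matrix entry `⟪v, Y (perp v)⟫` of `Y = y · σ`, with `σ` the Pauli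
matrices. For `y = bloch u`, `1 + Y` is twice the orthogonal projection to the line of `u`, and the
identity drops out because `v` is orthogonal to `perp v`. -/
theorem tangentMap_bloch (v : C2) {u : C2} (hu : u ≠ 0) :
    tangentMap v (bloch u) = 2 * (inner ℂ v u * inner ℂ u (perp v)) / (‖u‖ ^ 2 : ℝ) := by
  have hu0 : ((‖u‖ ^ 2 : ℝ) : ℂ) ≠ 0 := by simpa using hu
  rw [eq_div_iff hu0, bloch, map_smul, Complex.real_smul, Complex.ofReal_inv, mul_comm,
    mul_inv_cancel_left₀ hu0, inner_C2, inner_C2]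
  apply Complex.ext <;> simp [tangentMap, perp, pow_two] <;> ring

theorem normSq_tangentMap {v : C2} (hv : v ≠ 0) (y : R3) :
    Complex.normSq (tangentMap v y) =
      ‖v‖ ^ 4 * (‖y‖ ^ 2 - inner ℝ (bloch v) y ^ 2) := by
  have hv0 : ‖v‖ ^ 2 ≠ 0 := by simpa using hv
  have h : ‖v‖ ^ 4 * (‖y‖ ^ 2 - inner ℝ (bloch v) y ^ 2) =
      (‖v‖ ^ 2) ^ 2 * ‖y‖ ^ 2 - (‖v‖ ^ 2 * inner ℝ (bloch v) y) ^ 2 := by ring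
  rw [h, bloch, real_inner_smul_left, mul_inv_cancel_left₀ hv0, norm_sq_C2,
    EuclideanSpace.norm_sq_eq, Fin.sum_univ_three, inner_R3, Complex.normSq_apply]
  simp [tangentMap, pow_two]
  ring

theorem tangentMap_eq_zero_iff {v : C2} (hv : v ≠ 0) (y : R3) :
    tangentMap v y = 0 ↔ ∃ a : ℝ, y = a • bloch v := by
  have hv0 : ‖v‖ ≠ 0 := by simpa using hv
  rw [← Complex.normSq_eq_zero, normSq_tangentMap hv]
  constructor
  · intro h
    have h1 := (mul_eq_zero.1 h).resolve_left (pow_ne_zero 4 hv0)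
    refine ⟨inner ℝ (bloch v) y, ?_⟩
    rw [← sub_eq_zero, ← norm_eq_zero, ← sq_eq_zero_iff, norm_sub_sq_real, norm_smul,
      norm_bloch hv, real_inner_smul_right, real_inner_comm, Real.norm_eq_abs, mul_one, sq_abs]
    rw [real_inner_comm] at h1
    linarith
  · rintro ⟨a, rfl⟩
    rw [norm_smul, real_inner_smul_right, real_inner_self_eq_norm_sq, norm_bloch hv]
    simp

/-- The derivative of `chartVec`. -/
def chartDir (k : Fin 2) : C2 := if k = 0 then !₂[0, 1] else !₂[1, 0]

theorem hasDerivAt_inner_chartVec (u : C2) (k : Fin 2) (z : ℂ) :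
    HasDerivAt (fun w => inner ℂ u (chartVec k w)) (inner ℂ u (chartDir k)) z := by
  fin_cases k
  · simpa [inner_C2, chartVec, chartDir] using
      ((hasDerivAt_id z).mul_const ((starRingEnd ℂ) (u 1))).const_add ((starRingEnd ℂ) (u 0))
  · simpa [inner_C2, chartVec, chartDir] using
      ((hasDerivAt_id z).mul_const ((starRingEnd ℂ) (u 0))).add_const ((starRingEnd ℂ) (u 1))

theorem norm_chartVec_sq (k : Fin 2) (z : ℂ) : ‖chartVec k z‖ ^ 2 = 1 + ‖z‖ ^ 2 := by
  rw [EuclideanSpace.norm_sq_eq, Fin.sum_univ_two]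
  fin_cases k <;> simp [chartVec, add_comm]

/-- Differentiating a linear form along the chart splits into a part along `v`, which produces the
connection term `∂φ`, and a part along `perp v`, which is the covariant derivative. -/
theorem exists_chartDir_eq (k : Fin 2) (z : ℂ) : ∃ a : ℂ, a ≠ 0 ∧
    ((1 + ‖z‖ ^ 2 : ℝ) : ℂ) • chartDir k =
      (starRingEnd ℂ) z • chartVec k z + a • perp (chartVec k z) := by
  have h : (starRingEnd ℂ) z * z = ((‖z‖ ^ 2 : ℝ) : ℂ) := by
    rw [mul_comm, Complex.mul_conj, Complex.normSq_eq_norm_sq]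
  push_cast at h
  fin_cases k
  · refine ⟨1, one_ne_zero, ?_⟩
    ext j
    fin_cases j <;> simp [chartDir, chartVec, perp, h, add_comm]
  · refine ⟨-1, by norm_num, ?_⟩
    ext j
    fin_cases j <;> simp [chartDir, chartVec, perp, h, add_comm]

theorem chart_surjective (q : CP1) : ∃ k z, chart k z = q := by
  have hq := q.rep_nonzero
  by_cases h0 : q.rep 0 = 0
  · have h1 : q.rep 1 ≠ 0 := by
      intro h1
      refine hq ?_
      ext j
      fin_cases j <;> simp [h0, h1]
    refine ⟨1, 0, ?_⟩
    rw [chart, ← q.mk_rep, Projectivization.mk_eq_mk_iff']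
    refine ⟨(q.rep 1)⁻¹, ?_⟩
    ext j
    fin_cases j <;> simp [chartVec, h0, h1]
  · refine ⟨0, q.rep 1 / q.rep 0, ?_⟩
    rw [chart, ← q.mk_rep, Projectivization.mk_eq_mk_iff']
    refine ⟨(q.rep 0)⁻¹, ?_⟩
    ext j
    fin_cases j <;> simp [chartVec, h0]
    ring

theorem pt_chart (k : Fin 2) (z : ℂ) : pt (chart k z) = bloch (chartVec k z) := pt_mk _ _

theorem wirtinger_potential (n : ℕ) (z : ℂ) :
    wirtinger (HolSection.potential n) z = n * (starRingEnd ℂ) z / ((1 + ‖z‖ ^ 2 : ℝ) : ℂ) := by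
  have hpos : 0 < 1 + ‖z‖ ^ 2 := by positivity
  have h1 : HasFDerivAt (fun w : ℂ => n * Real.log (1 + ‖w‖ ^ 2))
      ((n : ℝ) • ((1 + ‖z‖ ^ 2)⁻¹ • (2 • innerSL ℝ z))) z := by
    have := (((hasStrictFDerivAt_norm_sq z).hasFDerivAt.const_add 1).log hpos.ne').const_mul (n : ℝ)
    exact this
  have h2 : HasFDerivAt (HolSection.potential n) (Complex.ofRealCLM.comp
      ((n : ℝ) • ((1 + ‖z‖ ^ 2)⁻¹ • (2 • innerSL ℝ z)))) z :=
    Complex.ofRealCLM.hasFDerivAt.comp z h1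
  rw [wirtinger, h2.fderiv]
  have hc : ((1 + ‖z‖ ^ 2 : ℝ) : ℂ) ≠ 0 := by exact_mod_cast hpos.ne'
  have e : (starRingEnd ℂ) z = z.re - Complex.I * z.im := by
    apply Complex.ext <;> simp
  have i1 : inner ℝ z 1 = z.re := by simp [Complex.inner]
  have i2 : inner ℝ z Complex.I = z.im := by simp [Complex.inner]
  rw [e]
  simp only [ContinuousLinearMap.comp_apply, smul_apply, innerSL_apply_apply,
    i1, i2, Complex.ofRealCLM_apply, smul_eq_mul, nsmul_eq_mul]
  push_cast
  push_cast at hc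
  field_simp

namespace HolSection

variable {n : ℕ}

/-- `s` is the product of the linear forms `⟪b i, ·⟫`, up to the constant `C`. -/
structure Factors (s : HolSection n) (C : ℂ) (b : Fin n → C2) : Prop where
  const_ne : C ≠ 0
  ne_zero : ∀ i, b i ≠ 0
  eq_prod : ∀ v : C2, v ≠ 0 → s.toFun v = C * ∏ i, inner ℂ (b i) v

theorem covDeriv_eq (s : HolSection n) (k : Fin 2) (z h : ℂ) :
    s.covDeriv k z h = (deriv (s.coeff k) z -
      s.coeff k z * (n * (starRingEnd ℂ) z / ((1 + ‖z‖ ^ 2 : ℝ) : ℂ))) * h := by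
  have := ((s.differentiable_coeff k z).hasDerivAt.hasFDerivAt.restrictScalars ℝ).fderiv
  rw [covDeriv, this, wirtinger_potential]
  simp
  ring

variable {s : HolSection n} {C : ℂ} {b : Fin n → C2}

theorem Factors.coeff_eq (hf : s.Factors C b) (k : Fin 2) (z : ℂ) :
    s.coeff k z = C * ∏ i, inner ℂ (b i) (chartVec k z) :=
  hf.eq_prod _ (chartVec_ne_zero k z)

theorem Factors.hasDerivAt_coeff (hf : s.Factors C b) (k : Fin 2) (z : ℂ) :
    HasDerivAt (s.coeff k) (C * ∑ i, (∏ j ∈ Finset.univ.erase i,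
      inner ℂ (b j) (chartVec k z)) * inner ℂ (b i) (chartDir k)) z := by
  have h := (HasDerivAt.fun_finsetProd (u := Finset.univ) (x := z)
    (fun i _ => hasDerivAt_inner_chartVec (b i) k z)).const_mul C
  rw [funext (hf.coeff_eq k)]
  simpa using h

/-- The zeros of `s` as points of the unit sphere. -/
def root (b : Fin n → C2) (i : Fin n) : R3 := -bloch (b i)

theorem Factors.norm_root (hf : s.Factors C b) (i : Fin n) : ‖root b i‖ = 1 := by
  rw [root, norm_neg, norm_bloch (hf.ne_zero i)]

theorem Factors.one_sub_inner_root (hf : s.Factors C b) (i : Fin n) {v : C2} (hv : v ≠ 0) :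
    1 - inner ℝ (bloch v) (root b i) =
      2 * (‖inner ℂ (b i) v‖ ^ 2 / (‖b i‖ ^ 2 * ‖v‖ ^ 2)) := by
  rw [root, inner_neg_right, sub_neg_eq_add, real_inner_comm, one_add_inner_bloch (hf.ne_zero i) hv]

theorem Factors.toFun_eq_zero_iff (hf : s.Factors C b) {v : C2} (hv : v ≠ 0) :
    s.toFun v = 0 ↔ ∃ i, bloch v = root b i := by
  rw [hf.eq_prod v hv, mul_eq_zero, Finset.prod_eq_zero_iff]
  simp only [hf.const_ne, false_or, Finset.mem_univ, true_and]
  refine exists_congr fun i => ?_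
  have hv0 : ‖v‖ ≠ 0 := by simpa using hv
  have hb0 : ‖b i‖ ≠ 0 := by simpa using hf.ne_zero i
  rw [← inner_eq_one_iff_of_norm_eq_one (𝕜 := ℝ) (norm_bloch hv) (hf.norm_root i),
    ← sub_eq_zero (a := inner ℝ _ _), ← neg_eq_zero (a := inner ℝ _ _ - _), neg_sub,
    hf.one_sub_inner_root i hv]
  simp [hv0, hb0]

theorem Factors.mem_zeros_iff (hf : s.Factors C b) {q : CP1} :
    q ∈ s.zeros ↔ ∃ i, pt q = root b i :=
  hf.toFun_eq_zero_iff q.rep_nonzero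

theorem Factors.normSq_eq (hf : s.Factors C b) : ∃ K : ℝ, 0 < K ∧
    ∀ q, s.normSq q = K * ∏ i, (1 - inner ℝ (pt q) (root b i)) := by
  have hb (i) : 0 < ‖b i‖ := norm_pos_iff.2 (hf.ne_zero i)
  refine ⟨‖C‖ ^ 2 * ∏ i, (‖b i‖ ^ 2 / 2), ?_, fun q => ?_⟩
  · have := hf.const_ne
    exact mul_pos (by positivity) (Finset.prod_pos fun i _ => by have := hb i; positivity)
  · have hq : ‖q.rep‖ ≠ 0 := by simpa using q.rep_nonzero
    have h (i : Fin n) : 1 - inner ℝ (pt q) (root b i) = _ :=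
      hf.one_sub_inner_root i q.rep_nonzero
    rw [normSq, hf.eq_prod _ q.rep_nonzero, mul_assoc, ← Finset.prod_mul_distrib, norm_mul,
      norm_prod, mul_pow, ← Finset.prod_pow, mul_div_assoc]
    congr 1
    have : ‖q.rep‖ ^ (2 * n) = ∏ _i : Fin n, ‖q.rep‖ ^ 2 := by simp [pow_mul]
    rw [this, ← Finset.prod_div_distrib]
    refine Finset.prod_congr rfl fun i _ => ?_
    rw [h]
    have := (hb i).ne'
    field_simp

/-- The tangential part of the `i`-th force is, up to a factor independent of `i`, the logarithmic
derivative of the `i`-th linear form along `perp v`. -/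
theorem Factors.tangentMap_root (hf : s.Factors C b) (i : Fin n) {v : C2} (hv : v ≠ 0)
    (h : inner ℂ (b i) v ≠ 0) :
    tangentMap v ((1 - inner ℝ (bloch v) (root b i))⁻¹ • root b i) =
      -((‖v‖ ^ 2 : ℝ) : ℂ) * (inner ℂ (b i) (perp v) / inner ℂ (b i) v) := by
  have hb0 : (‖b i‖ : ℂ) ≠ 0 := by simpa using hf.ne_zero i
  have hv0 : (‖v‖ : ℂ) ≠ 0 := by simpa using hv
  have hc : inner ℂ v (b i) = (starRingEnd ℂ) (inner ℂ (b i) v) := (inner_conj_symm _ _).symm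
  have hcc : ((‖inner ℂ (b i) v‖ ^ 2 : ℝ) : ℂ) =
      inner ℂ (b i) v * (starRingEnd ℂ) (inner ℂ (b i) v) := by
    rw [Complex.mul_conj, Complex.normSq_eq_norm_sq]
  have hc0 : (starRingEnd ℂ) (inner ℂ (b i) v) ≠ 0 :=
    (map_ne_zero _).2 h
  rw [map_smul, hf.one_sub_inner_root i hv, root, map_neg, tangentMap_bloch v (hf.ne_zero i),
    Complex.real_smul, hc, Complex.ofReal_inv, Complex.ofReal_mul, Complex.ofReal_div, hcc]
  push_cast
  field_simp

/-- Away from the zeros, `∇ s = 0` is the vanishing of the tangential part of the resultant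
force `∑ i, (1 - ⟪x, p i⟫)⁻¹ • p i`. -/
theorem Factors.covDeriv_eq_zero_iff (hf : s.Factors C b) {k : Fin 2} {z : ℂ}
    (hz : s.coeff k z ≠ 0) :
    (∀ h, s.covDeriv k z h = 0) ↔ ∃ a : ℝ,
      ∑ i, (1 - inner ℝ (pt (chart k z)) (root b i))⁻¹ • root b i = a • pt (chart k z) := by
  set v := chartVec k z with hv
  have hv0 : v ≠ 0 := chartVec_ne_zero k z
  have hne (i : Fin n) : inner ℂ (b i) v ≠ 0 := by
    rw [hf.coeff_eq] at hz
    exact Finset.prod_ne_zero_iff.1 (right_ne_zero_of_mul hz) i (Finset.mem_univ i)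
  obtain ⟨a, ha, hdir⟩ := exists_chartDir_eq k z
  have hN : ((1 + ‖z‖ ^ 2 : ℝ) : ℂ) ≠ 0 := by
    have : 0 < 1 + ‖z‖ ^ 2 := by positivity
    exact_mod_cast this.ne'
  have hder : deriv (s.coeff k) z = s.coeff k z *
      ∑ i, inner ℂ (b i) (chartDir k) / inner ℂ (b i) v := by
    rw [(hf.hasDerivAt_coeff k z).deriv, hf.coeff_eq, ← hv, mul_assoc]
    congr 1
    rw [Finset.mul_sum]
    refine Finset.sum_congr rfl fun i hi => ?_
    rw [← Finset.mul_prod_erase _ _ hi]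
    have := hne i
    field_simp
  -- The first summand is `∂φ`, which the connection subtracts.
  have hsum : (∑ i, inner ℂ (b i) (chartDir k) / inner ℂ (b i) v : ℂ) =
      n * (starRingEnd ℂ) z / ((1 + ‖z‖ ^ 2 : ℝ) : ℂ) +
      a / ((1 + ‖z‖ ^ 2 : ℝ) : ℂ) * ∑ i, inner ℂ (b i) (perp v) / inner ℂ (b i) v := by
    have hterm (i : Fin n) : inner ℂ (b i) (chartDir k) / inner ℂ (b i) v =
        (starRingEnd ℂ) z / ((1 + ‖z‖ ^ 2 : ℝ) : ℂ) +
        a / ((1 + ‖z‖ ^ 2 : ℝ) : ℂ) * (inner ℂ (b i) (perp v) / inner ℂ (b i) v) := by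
      have h := congrArg (fun u => inner ℂ (b i) u) hdir
      simp only [inner_smul_right, inner_add_right, ← hv] at h
      have := hne i
      have e : inner ℂ (b i) (chartDir k) = ((starRingEnd ℂ) z * inner ℂ (b i) v +
          a * inner ℂ (b i) (perp v)) / ((1 + ‖z‖ ^ 2 : ℝ) : ℂ) := by
        rw [eq_div_iff hN, ← h]; ring
      rw [e]
      field_simp
    rw [Finset.sum_congr rfl fun i _ => hterm i, Finset.sum_add_distrib, Finset.mul_sum]
    simp
    ring
  have hcrit : (∀ h, s.covDeriv k z h = 0) ↔
      (∑ i, inner ℂ (b i) (perp v) / inner ℂ (b i) v : ℂ) = 0 := by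
    have h1 (h : ℂ) : s.covDeriv k z h = s.coeff k z * (a / ((1 + ‖z‖ ^ 2 : ℝ) : ℂ) *
        ∑ i, inner ℂ (b i) (perp v) / inner ℂ (b i) v) * h := by
      rw [covDeriv_eq, hder, hsum]; ring
    constructor
    · intro h
      have := h 1
      rw [h1, mul_one] at this
      exact (mul_eq_zero.1 ((mul_eq_zero.1 this).resolve_left hz)).resolve_left
        (div_ne_zero ha hN)
    · intro h h'
      rw [h1, h]; simp
  have hv2 : -((‖v‖ ^ 2 : ℝ) : ℂ) ≠ 0 := by simpa using hv0
  rw [hcrit, pt_chart, ← hv, ← tangentMap_eq_zero_iff hv0, map_sum,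
    Finset.sum_congr rfl fun i _ => hf.tangentMap_root i hv0 (hne i), ← Finset.mul_sum,
    mul_eq_zero, or_iff_right hv2]

theorem mem_zeros_chart_iff {s : HolSection n} {k : Fin 2} {z : ℂ} :
    chart k z ∈ s.zeros ↔ s.coeff k z = 0 := by
  obtain ⟨a, ha⟩ := Projectivization.exists_smul_eq_mk_rep ℂ (chartVec k z) (chartVec_ne_zero k z)
  have e : s.toFun (chart k z).rep = (a : ℂ) ^ n * s.coeff k z := by
    rw [chart, ← ha, Units.smul_def, s.homogeneous _ _ a.ne_zero (chartVec_ne_zero k z), coeff]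
  change s.toFun (chart k z).rep = 0 ↔ _
  rw [e, mul_eq_zero, or_iff_right (pow_ne_zero _ a.ne_zero)]

theorem Factors.mem_criticalSet_iff (hf : s.Factors C b) {q : CP1} (hq : q ∉ s.zeros) :
    q ∈ s.criticalSet ↔
      ∃ a : ℝ, ∑ i, (1 - inner ℝ (pt q) (root b i))⁻¹ • root b i = a • pt q := by
  constructor
  · intro h
    obtain ⟨k, z, rfl⟩ := chart_surjective q
    exact (hf.covDeriv_eq_zero_iff (fun h0 => hq (mem_zeros_chart_iff.2 h0))).1 (h k z rfl)
  · rintro h k z rfl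
    exact (hf.covDeriv_eq_zero_iff (fun h0 => hq (mem_zeros_chart_iff.2 h0))).2 h

end HolSection

/-! ### A discrete mountain pass argument -/

/-- If a continuous self-map of a compact connected space decreases a nonnegative function `u`
off its zeros and fixes these, and there are finitely many of them, then there is at most one:
the basins of attraction are open and disjoint, and cover the space. -/
theorem subsingleton_of_descent {X : Type*} [TopologicalSpace X] [T2Space X] [CompactSpace X]
    [PreconnectedSpace X] {F : X → X} (hF : Continuous F) {u : X → ℝ} (hu : Continuous u)
    (h0 : ∀ x, 0 ≤ u x) (hdesc : ∀ x, u x ≠ 0 → u (F x) < u x) (hfix : ∀ x, u x = 0 → F x = x)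
    (hfin : {x | u x = 0}.Finite) : {x | u x = 0}.Subsingleton := by
  intro z₁ hz₁ z₂ hz₂
  by_contra hne
  obtain ⟨A, B, hA, hB, hzA, hzB, hAB⟩ :
      SeparatedNhds ({z₁} : Set X) ({x | u x = 0} \ {z₁}) :=
    SeparatedNhds.of_isCompact_isCompact isCompact_singleton hfin.sdiff.isCompact
      Set.disjoint_sdiff_right
  have hmem (z : X) (hz : u z = 0) : z ∈ A ∨ z ∈ B := by
    by_cases h : z = z₁
    · exact Or.inl (hzA h)
    · exact Or.inr (hzB ⟨hz, h⟩)
  -- Points that one step of `F` does not move across between `A` and `B`. Below the level `δ` found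
  -- next, every point is of this kind, so orbits are trapped on one side.
  set N : Set X := (A ∩ F ⁻¹' A) ∪ (B ∩ F ⁻¹' B) with hN
  have hNo : IsOpen N := (hA.inter (hA.preimage hF)).union (hB.inter (hB.preimage hF))
  have hZN (z : X) (hz : u z = 0) : z ∈ N := by
    rcases hmem z hz with h | h
    · exact Or.inl ⟨h, by rwa [Set.mem_preimage, hfix z hz]⟩
    · exact Or.inr ⟨h, by rwa [Set.mem_preimage, hfix z hz]⟩
  have lower {K : Set X} (hK : IsClosed K) {g : X → ℝ} (hg : Continuous g)
      (hpos : ∀ x ∈ K, 0 < g x) : ∃ δ > 0, ∀ x ∈ K, δ ≤ g x := by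
    rcases K.eq_empty_or_nonempty with rfl | hKn
    · exact ⟨1, one_pos, fun x hx => hx.elim⟩
    · obtain ⟨x, hx, hmin⟩ := hK.isCompact.exists_isMinOn hKn hg.continuousOn
      exact ⟨g x, hpos x hx, fun y hy => hmin hy⟩
  obtain ⟨δ, hδ, hlow⟩ := lower hNo.isClosed_compl hu fun x hx =>
    lt_of_le_of_ne (h0 x) fun h => hx (hZN x h.symm)
  have hsmall (x : X) (hx : u x < δ) : x ∈ N := by
    by_contra h
    exact absurd (hlow x h) (not_le.2 hx)
  have hle (x : X) : u (F x) ≤ u x := by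
    by_cases h : u x = 0
    · rw [hfix x h]
    · exact (hdesc x h).le
  -- By compactness each step costs at least `η` while `u ≥ δ`, so every orbit falls below `δ`.
  obtain ⟨η, hη, hgap⟩ := lower (isClosed_le continuous_const hu : IsClosed {x | δ ≤ u x})
    (hu.sub (hu.comp hF)) fun x hx => sub_pos.2 (hdesc x (hδ.trans_le hx).ne')
  have hreach (x : X) : ∃ k, u (F^[k] x) < δ := by
    by_contra! h
    have hb (k : ℕ) : u (F^[k] x) ≤ u x - k * η := by
      induction k with
      | zero => simp
      | succ k ih =>
        have := hgap _ (h k)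
        change η ≤ u (F^[k] x) - u (F (F^[k] x)) at this
        rw [Function.iterate_succ_apply']
        push_cast
        linarith
    obtain ⟨k, hk⟩ := exists_nat_gt (u x / η)
    rw [div_lt_iff₀ hη] at hk
    linarith [hb k, h0 (F^[k] x)]
  have trapA (x : X) (h : u x < δ ∧ x ∈ A) : u (F x) < δ ∧ F x ∈ A := by
    refine ⟨(hle x).trans_lt h.1, ?_⟩
    rcases hsmall x h.1 with h' | h'
    · exact h'.2
    · exact (Set.disjoint_left.1 hAB h.2 h'.1).elim
  have trapB (x : X) (h : u x < δ ∧ x ∈ B) : u (F x) < δ ∧ F x ∈ B := by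
    refine ⟨(hle x).trans_lt h.1, ?_⟩
    rcases hsmall x h.1 with h' | h'
    · exact (Set.disjoint_left.1 hAB h'.1 h.2).elim
    · exact h'.2
  have iter {S : Set X} (hS : ∀ x, u x < δ ∧ x ∈ S → u (F x) < δ ∧ F x ∈ S) {x : X} {k m : ℕ}
      (hkm : k ≤ m) (h : u (F^[k] x) < δ ∧ F^[k] x ∈ S) : u (F^[m] x) < δ ∧ F^[m] x ∈ S := by
    induction m, hkm using Nat.le_induction with
    | base => exact h
    | succ m _ ih =>
      rw [Function.iterate_succ_apply']
      exact hS _ ih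
  let W (S : Set X) : Set X := ⋃ k : ℕ, {x | u (F^[k] x) < δ ∧ F^[k] x ∈ S}
  have hW {S : Set X} (hS : IsOpen S) : IsOpen (W S) := by
    refine isOpen_iUnion fun k => ?_
    have hk : Continuous F^[k] := hF.iterate k
    exact (isOpen_lt (hu.comp hk) continuous_const).inter (hS.preimage hk)
  have hcover : Set.univ ⊆ W A ∪ W B := by
    intro x _
    obtain ⟨k, hk⟩ := hreach x
    rcases hsmall _ hk with h | h
    · exact Or.inl (Set.mem_iUnion.2 ⟨k, hk, h.1⟩)
    · exact Or.inr (Set.mem_iUnion.2 ⟨k, hk, h.1⟩)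
  have hz₂' : z₂ ∈ B := hzB ⟨hz₂, fun h => hne h.symm⟩
  have hu₁ : u z₁ < δ := by rw [show u z₁ = 0 from hz₁]; exact hδ
  have hu₂ : u z₂ < δ := by rw [show u z₂ = 0 from hz₂]; exact hδ
  obtain ⟨x, -, hxA, hxB⟩ := isPreconnected_univ (W A) (W B) (hW hA) (hW hB) hcover
    ⟨z₁, trivial, Set.mem_iUnion.2 ⟨0, hu₁, hzA rfl⟩⟩
    ⟨z₂, trivial, Set.mem_iUnion.2 ⟨0, hu₂, hz₂'⟩⟩
  obtain ⟨k, hk⟩ := Set.mem_iUnion.1 hxA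
  obtain ⟨m, hm⟩ := Set.mem_iUnion.1 hxB
  exact Set.disjoint_left.1 hAB (iter trapA (le_max_left k m) hk).2
    (iter trapB (le_max_right k m) hm).2

/-! ### Critical points on the sphere -/

section Sphere

variable {ι : Type*} [Fintype ι] {p : ι → R3}

/-- The resultant of the forces that act on a point `x` of the sphere: up to sign, the gradient
of `∑ i, log (1 - ⟪x, p i⟫)`. -/
def force (p : ι → R3) (x : R3) : R3 := ∑ i, (1 - inner ℝ x (p i))⁻¹ • p i

theorem one_sub_inner_nonneg {x y : R3} (hx : ‖x‖ = 1) (hy : ‖y‖ = 1) :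
    0 ≤ 1 - inner ℝ x y := by
  have := real_inner_le_norm x y
  rw [hx, hy] at this
  linarith

theorem one_sub_inner_pos {x y : R3} (hx : ‖x‖ = 1) (hy : ‖y‖ = 1) (h : x ≠ y) :
    0 < 1 - inner ℝ x y :=
  lt_of_le_of_ne (one_sub_inner_nonneg hx hy) fun h0 =>
    h ((inner_eq_one_iff_of_norm_eq_one (𝕜 := ℝ) hx hy).1 (by linarith))

theorem one_sub_inner_eq_zero_iff {x y : R3} (hx : ‖x‖ = 1) (hy : ‖y‖ = 1) :
    1 - inner ℝ x y = 0 ↔ x = y := by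
  rw [sub_eq_zero, eq_comm, inner_eq_one_iff_of_norm_eq_one hx hy]

theorem inner_force_pos [Nonempty ι] {c x : R3} (hp : ∀ i, ‖p i‖ = 1)
    (hc : ∀ i, 0 < inner ℝ c (p i)) (hx : ‖x‖ = 1) (hxp : ∀ i, x ≠ p i) :
    0 < inner ℝ c (force p x) := by
  rw [force, inner_sum]
  refine Finset.sum_pos (fun i _ => ?_) Finset.univ_nonempty
  rw [inner_smul_right]
  exact mul_pos (inv_pos.2 (one_sub_inner_pos hx (hp i) (hxp i))) (hc i)

/-- A point at which the force is normal to the sphere is a strictly positive combination of the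
`p i` or of the `-p i`, according to the hemisphere in which it lies. -/
theorem pos_combination_of_force_eq [Nonempty ι] {c x : R3} {a : ℝ} (hp : ∀ i, ‖p i‖ = 1)
    (hc : ∀ i, 0 < inner ℝ c (p i)) (hx : ‖x‖ = 1) (hxp : ∀ i, x ≠ p i)
    (ha : force p x = a • x) :
    (0 < inner ℝ c x ∧ ∃ t : ι → ℝ, (∀ i, 0 < t i) ∧ x = ∑ i, t i • p i) ∨
    (inner ℝ c x < 0 ∧ ∃ t : ι → ℝ, (∀ i, 0 < t i) ∧ x = ∑ i, t i • (-p) i) := by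
  have h := inner_force_pos hp hc hx hxp
  have hpos (i : ι) : 0 < (1 - inner ℝ x (p i))⁻¹ :=
    inv_pos.2 (one_sub_inner_pos hx (hp i) (hxp i))
  rw [ha, inner_smul_right] at h
  have ha0 : a ≠ 0 := by rintro rfl; simp at h
  have hx' : x = ∑ i, (a⁻¹ * (1 - inner ℝ x (p i))⁻¹) • p i := by
    simp_rw [mul_smul]
    rw [← Finset.smul_sum]
    change x = a⁻¹ • force p x
    rw [ha, inv_smul_smul₀ ha0]
  rcases lt_or_gt_of_ne ha0 with hneg | hpos'
  · refine Or.inr ⟨by nlinarith, fun i => (-a)⁻¹ * (1 - inner ℝ x (p i))⁻¹,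
      fun i => mul_pos (inv_pos.2 (by linarith)) (hpos i), ?_⟩
    conv_lhs => rw [hx']
    refine Finset.sum_congr rfl fun i _ => ?_
    simp only [Pi.neg_apply, smul_neg, ← neg_smul, inv_neg, neg_mul, neg_neg]
  · exact Or.inl ⟨by nlinarith, fun i => a⁻¹ * (1 - inner ℝ x (p i))⁻¹,
      fun i => mul_pos (inv_pos.2 hpos') (hpos i), hx'⟩

/-- The left side is the force with denominators cleared; it remains continuous at the `p i`. -/
theorem sum_prod_erase_smul [DecidableEq ι] {x : R3} (hne : ∀ i, 1 - inner ℝ x (p i) ≠ 0) :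
    ∑ i, (∏ j ∈ Finset.univ.erase i, (1 - inner ℝ x (p j))) • p i =
      (∏ i, (1 - inner ℝ x (p i))) • force p x := by
  rw [force, Finset.smul_sum]
  refine Finset.sum_congr rfl fun i hi => ?_
  rw [smul_smul, ← Finset.mul_prod_erase _ _ hi]
  congr 1
  have := hne i
  field_simp

/-- At a maximum of `∏ i, (1 - ⟪x, p i⟫)` on the sphere the force is normal. -/
theorem force_eq_of_isMax {x : R3} (hp : ∀ i, ‖p i‖ = 1)
    (hx : ‖x‖ = 1) (hxp : ∀ i, x ≠ p i)
    (hmax : ∀ y : R3, ‖y‖ = 1 → ∏ i, (1 - inner ℝ y (p i)) ≤ ∏ i, (1 - inner ℝ x (p i))) :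
    ∃ a : ℝ, force p x = a • x := by
  classical
  have hpos (i : ι) := one_sub_inner_pos hx (hp i) (hxp i)
  set w := force p x - inner ℝ x (force p x) • x with hw
  have hxx : inner ℝ x x = 1 := by rw [real_inner_self_eq_norm_sq, hx, one_pow]
  have hxw : inner ℝ x w = 0 := by
    rw [hw, inner_sub_right, inner_smul_right, hxx, mul_one, sub_self]
  suffices h : w = 0 from ⟨_, sub_eq_zero.1 h⟩
  by_contra hw0
  set d := ‖w‖⁻¹ • w with hd
  have hxd : inner ℝ x d = 0 := by rw [hd, inner_smul_right, hxw, mul_zero]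
  have hdn : ‖d‖ = 1 := norm_smul_inv_norm hw0
  have hdd : inner ℝ d d = 1 := by rw [real_inner_self_eq_norm_sq, hdn, one_pow]
  have hdV : inner ℝ d (force p x) = 0 := by
    -- The great circle through `x` in the direction of the tangential part of the force; the
    -- product is stationary along it.
    let γ : ℝ → R3 := fun t => Real.cos t • x + Real.sin t • d
    have hγ (t : ℝ) : ‖γ t‖ = 1 := by
      have : ‖γ t‖ ^ 2 = 1 := by
        rw [← real_inner_self_eq_norm_sq]
        simp only [γ, inner_add_left, inner_add_right, inner_smul_left, inner_smul_right, hxx,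
          hxd, hdd]
        rw [real_inner_comm, hxd]
        simpa [pow_two] using Real.cos_sq_add_sin_sq t
      nlinarith [norm_nonneg (γ t)]
    have hγ0 : γ 0 = x := by simp [γ]
    have hder (i : ι) : HasDerivAt (fun t => 1 - inner ℝ (γ t) (p i)) (-inner ℝ d (p i)) 0 := by
      have h1 := (((Real.hasDerivAt_cos 0).mul_const (inner ℝ x (p i))).add
        ((Real.hasDerivAt_sin 0).mul_const (inner ℝ d (p i)))).const_sub 1
      simpa [γ, inner_add_left, real_inner_smul_left] using h1
    have hprod := HasDerivAt.fun_finsetProd (u := Finset.univ) (x := (0 : ℝ)) fun i _ => hder i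
    have hloc : IsLocalMax (fun t => ∏ i, (1 - inner ℝ (γ t) (p i))) 0 := by
      refine Filter.Eventually.of_forall fun t => ?_
      simp only [hγ0]
      exact hmax _ (hγ t)
    have h0 := hloc.hasDerivAt_eq_zero hprod
    rw [hγ0] at h0
    have h1 := congrArg (fun y => inner ℝ d y) (sum_prod_erase_smul fun i => (hpos i).ne')
    simp only [inner_sum, inner_smul_right] at h1
    simp only [smul_eq_mul, mul_neg, Finset.sum_neg_distrib, neg_eq_zero] at h0
    rw [h0] at h1
    exact (mul_eq_zero.1 h1.symm).resolve_left
      (Finset.prod_ne_zero_iff.2 fun i _ => (hpos i).ne')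
  have hwV : inner ℝ w (force p x) = 0 := by
    rw [hd, inner_smul_left] at hdV
    exact (mul_eq_zero.1 hdV).resolve_left (by simpa using hw0)
  have : inner ℝ w w = 0 := by
    conv_lhs => rw [hw, inner_sub_right, inner_smul_right]
    rw [← hw, hwV, real_inner_comm x w, hxw]; simp
  exact hw0 (inner_self_eq_zero.1 this)

/-- The maximum of `∏ i, (1 - ⟪x, p i⟫)` on the sphere lies in the hemisphere opposite to the
one that contains the `p i`. -/
theorem exists_max_prod [Nonempty ι] {c : R3} (hp : ∀ i, ‖p i‖ = 1) (hcn : ‖c‖ = 1)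
    (hc : ∀ i, 0 < inner ℝ c (p i)) :
    ∃ x : R3, ‖x‖ = 1 ∧ (∀ i, x ≠ p i) ∧ inner ℝ c x ≤ 0 ∧
      (∃ a : ℝ, force p x = a • x) ∧
      ∀ y : R3, ‖y‖ = 1 → ∏ i, (1 - inner ℝ y (p i)) ≤ ∏ i, (1 - inner ℝ x (p i)) := by
  have hcont : Continuous fun y : R3 => ∏ i, (1 - inner ℝ y (p i)) := by fun_prop
  obtain ⟨x, hx, hmax⟩ := (isCompact_sphere (0 : R3) 1).exists_isMaxOn
    ⟨c, by simpa using hcn⟩ hcont.continuousOn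
  replace hx : ‖x‖ = 1 := by simpa using hx
  replace hmax (y : R3) (hy : ‖y‖ = 1) :
      ∏ i, (1 - inner ℝ y (p i)) ≤ ∏ i, (1 - inner ℝ x (p i)) := hmax (by simpa using hy)
  -- The product vanishes at `p i` but is positive at `-c`, where its factors are `1 + ⟪c, p j⟫`.
  have hxp (i : ι) : x ≠ p i := by
    intro h
    have h1 := hmax (-c) (by rwa [norm_neg])
    rw [Finset.prod_eq_zero (f := fun i => 1 - inner ℝ x (p i)) (Finset.mem_univ i)
      ((one_sub_inner_eq_zero_iff hx (hp i)).2 h)] at h1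
    refine absurd h1 (not_le.2 (Finset.prod_pos fun j _ => ?_))
    rw [inner_neg_left]
    linarith [hc j]
  refine ⟨x, hx, hxp, ?_, force_eq_of_isMax hp hx hxp hmax, hmax⟩
  by_contra! hcx
  have hcc : inner ℝ c c = 1 := by rw [real_inner_self_eq_norm_sq, hcn, one_pow]
  -- Reflection in the plane `cᗮ` strictly increases every factor.
  refine absurd (hmax (x - (2 * inner ℝ c x) • c) ?_) (not_le.2 ?_)
  · have : ‖x - (2 * inner ℝ c x) • c‖ ^ 2 = 1 := by
      rw [norm_sub_sq_real, norm_smul, hcn, hx, inner_smul_right, real_inner_comm, Real.norm_eq_abs,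
        mul_one, sq_abs]
      ring
    nlinarith [norm_nonneg (x - (2 * inner ℝ c x) • c)]
  · refine Finset.prod_lt_prod_of_nonempty (fun i _ => one_sub_inner_pos hx (hp i) (hxp i))
      (fun i _ => ?_) Finset.univ_nonempty
    rw [inner_sub_left, inner_smul_left]
    have := mul_pos hcx (hc i)
    simp only [conj_trivial]
    linarith

end Sphere

/-- The unit vectors of the cone generated by the `p i`. -/
def sphericalHull {ι : Type*} (p : ι → R3) : Set R3 := {x | ‖x‖ = 1 ∧ x ∈ coneSpan p}

theorem normalize_mem_sphericalHull {ι : Type*} {p : ι → R3} {y : R3} (hy : y ∈ coneSpan p) (hy0 : y ≠ 0) :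
    ‖y‖⁻¹ • y ∈ sphericalHull p :=
  ⟨norm_smul_inv_norm hy0, smul_mem_coneSpan (by positivity) hy⟩

/-! ### The spherical hull and the equilibrium inside it -/

section Cone

variable {ι : Type*} [Fintype ι] {p : ι → R3} {c : R3}

theorem sum_smul_ne_zero (hc : ∀ i, 0 < inner ℝ c (p i)) {t : ι → ℝ} (ht : ∀ i, 0 ≤ t i)
    (h : ∃ i, 0 < t i) : ∑ i, t i • p i ≠ 0 := by
  intro h0
  obtain ⟨j, hj⟩ := h
  have h1 : 0 < ∑ i, t i * inner ℝ c (p i) :=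
    Finset.sum_pos' (fun i _ => mul_nonneg (ht i) (hc i).le)
      ⟨j, Finset.mem_univ j, mul_pos hj (hc j)⟩
  have h2 := congrArg (fun y => inner ℝ c y) h0
  simp only [inner_sum, inner_smul_right, inner_zero_right] at h2
  exact h1.ne' h2

theorem stdSimplex_subset_nonneg_pos :
    stdSimplex ℝ ι ⊆ {t | (∀ i, 0 ≤ t i) ∧ ∃ i, 0 < t i} := by
  intro t ht
  refine ⟨ht.1, ?_⟩
  by_contra! h
  have := Finset.sum_nonpos fun i (_ : i ∈ Finset.univ) => h i
  rw [ht.2] at this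
  linarith

theorem sphericalHull_eq_image (hc : ∀ i, 0 < inner ℝ c (p i)) :
    sphericalHull p =
      (fun t : ι → ℝ => ‖∑ i, t i • p i‖⁻¹ • ∑ i, t i • p i) '' stdSimplex ℝ ι := by
  ext x
  constructor
  · rintro ⟨hx, hxp⟩
    obtain ⟨t, ht, rfl⟩ := mem_coneSpan_iff.1 hxp
    have hT : 0 < ∑ i, t i := by
      refine lt_of_le_of_ne (Finset.sum_nonneg fun i _ => ht i) fun h => ?_
      have h0 := (Finset.sum_eq_zero_iff_of_nonneg fun i _ => ht i).1 h.symm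
      rw [Finset.sum_eq_zero fun i hi => by rw [h0 i hi, zero_smul]] at hx
      simp at hx
    refine ⟨fun i => (∑ i, t i)⁻¹ * t i,
      ⟨fun i => mul_nonneg (inv_pos.2 hT).le (ht i), ?_⟩, ?_⟩
    · rw [← Finset.mul_sum, inv_mul_cancel₀ hT.ne']
    · simp only [mul_smul]
      rw [← Finset.smul_sum, norm_smul, hx, mul_one, Real.norm_of_nonneg (inv_pos.2 hT).le,
        inv_inv, smul_inv_smul₀ hT.ne']
  · rintro ⟨t, ht, rfl⟩
    exact normalize_mem_sphericalHull (mem_coneSpan_iff.2 ⟨t, ht.1, rfl⟩)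
      (sum_smul_ne_zero hc ht.1 (stdSimplex_subset_nonneg_pos ht).2)

/-- The domain is larger than the simplex so that unnormalized weights are allowed. -/
theorem continuousOn_normalize_sum (hc : ∀ i, 0 < inner ℝ c (p i)) :
    ContinuousOn (fun t : ι → ℝ => ‖∑ i, t i • p i‖⁻¹ • ∑ i, t i • p i)
      {t | (∀ i, 0 ≤ t i) ∧ ∃ i, 0 < t i} := by
  have h : Continuous fun t : ι → ℝ => ∑ i, t i • p i := by fun_prop
  exact (h.norm.continuousOn.inv₀ fun t ht =>
    norm_ne_zero_iff.2 (sum_smul_ne_zero hc ht.1 ht.2)).smul h.continuousOn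

theorem isCompact_sphericalHull (hc : ∀ i, 0 < inner ℝ c (p i)) :
    IsCompact (sphericalHull p) := by
  rw [sphericalHull_eq_image hc]
  exact (isCompact_stdSimplex ℝ ι).image_of_continuousOn
    ((continuousOn_normalize_sum hc).mono stdSimplex_subset_nonneg_pos)

theorem isPreconnected_sphericalHull (hc : ∀ i, 0 < inner ℝ c (p i)) :
    IsPreconnected (sphericalHull p) := by
  rw [sphericalHull_eq_image hc]
  exact (convex_stdSimplex ℝ ι).isPreconnected.image _
    ((continuousOn_normalize_sum hc).mono stdSimplex_subset_nonneg_pos)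

/-- Moving to the direction of the force decreases `∏ i, (1 - ⟪x, p i⟫)`. -/
theorem prod_lt_of_force {x y : R3} (hp : ∀ i, ‖p i‖ = 1) (hx : ‖x‖ = 1) (hxp : ∀ i, x ≠ p i)
    (hy : ‖y‖ = 1) (h : 0 < inner ℝ (force p x) (y - x)) :
    ∏ i, (1 - inner ℝ y (p i)) < ∏ i, (1 - inner ℝ x (p i)) := by
  have hpos (i : ι) := one_sub_inner_pos hx (hp i) (hxp i)
  have hle (i : ι) : 1 - inner ℝ y (p i) ≤
      (1 - inner ℝ x (p i)) * Real.exp (-((1 - inner ℝ x (p i))⁻¹ * inner ℝ (p i) (y - x))) := by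
    -- The tangent bound for the concave function `log (1 - ⟪·, p i⟫)`, in exponential form.
    have h1 := Real.add_one_le_exp (-((1 - inner ℝ x (p i))⁻¹ * inner ℝ (p i) (y - x)))
    have h2 := mul_le_mul_of_nonneg_left h1 (hpos i).le
    refine le_trans (le_of_eq ?_) h2
    have := (hpos i).ne'
    rw [mul_add, mul_neg, mul_inv_cancel_left₀ this, inner_sub_right, real_inner_comm,
      real_inner_comm x]
    ring
  calc ∏ i, (1 - inner ℝ y (p i))
      ≤ ∏ i, ((1 - inner ℝ x (p i)) *
          Real.exp (-((1 - inner ℝ x (p i))⁻¹ * inner ℝ (p i) (y - x)))) :=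
        Finset.prod_le_prod (fun i _ => one_sub_inner_nonneg hy (hp i)) fun i _ => hle i
    _ = (∏ i, (1 - inner ℝ x (p i))) * Real.exp (-inner ℝ (force p x) (y - x)) := by
        rw [Finset.prod_mul_distrib, ← Real.exp_sum, Finset.sum_neg_distrib, force, sum_inner]
        simp only [real_inner_smul_left]
    _ < ∏ i, (1 - inner ℝ x (p i)) :=
        mul_lt_of_lt_one_right (Finset.prod_pos fun i _ => hpos i) (by simpa using h)

/-- Between at least two distinct points of an open hemisphere there is an equilibrium. -/
theorem exists_equilibrium_mem_coneSpan [Nontrivial ι] (hp : ∀ i, ‖p i‖ = 1)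
    (hinj : Function.Injective p) (hc : ∀ i, 0 < inner ℝ c (p i)) :
    ∃ x : R3, ‖x‖ = 1 ∧ (∀ i, x ≠ p i) ∧ x ∈ coneSpan p ∧ ∃ a : ℝ, force p x = a • x := by
  classical
  by_contra! hno
  have : CompactSpace (sphericalHull p) :=
    isCompact_iff_compactSpace.1 (isCompact_sphericalHull hc)
  have : PreconnectedSpace (sphericalHull p) :=
    Subtype.preconnectedSpace (isPreconnected_sphericalHull hc)
  -- Weights of the force with cleared denominators. At `p i` only the `i`-th weight survives, as
  -- the points are distinct, so the normalized map `F` fixes `p i`.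
  let w : R3 → ι → ℝ := fun x i => ∏ j ∈ Finset.univ.erase i, (1 - inner ℝ x (p j))
  have hw (x : sphericalHull p) : (∀ i, 0 ≤ w x i) ∧ ∃ i, 0 < w x i := by
    refine ⟨fun i => Finset.prod_nonneg fun j _ => one_sub_inner_nonneg x.2.1 (hp j), ?_⟩
    by_cases h : ∃ i, (x : R3) = p i
    · obtain ⟨i, hi⟩ := h
      refine ⟨i, Finset.prod_pos fun j hj => one_sub_inner_pos x.2.1 (hp j) fun h => ?_⟩
      exact Finset.ne_of_mem_erase hj (hinj (h.symm.trans hi))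
    · push Not at h
      obtain ⟨i⟩ : Nonempty ι := inferInstance
      exact ⟨i, Finset.prod_pos fun j _ => one_sub_inner_pos x.2.1 (hp j) (h j)⟩
  have hwne (x : sphericalHull p) := sum_smul_ne_zero hc (hw x).1 (hw x).2
  let F : sphericalHull p → sphericalHull p := fun x =>
    ⟨‖∑ i, w x i • p i‖⁻¹ • ∑ i, w x i • p i,
      normalize_mem_sphericalHull (mem_coneSpan_iff.2 ⟨w x, (hw x).1, rfl⟩) (hwne x)⟩
  have hwc : Continuous fun x : sphericalHull p => w x := by
    refine continuous_pi fun i => ?_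
    fun_prop
  have hF : Continuous F :=
    ((continuousOn_normalize_sum hc).comp_continuous hwc hw).subtype_mk _
  let u : sphericalHull p → ℝ := fun x => ∏ i, (1 - inner ℝ (x : R3) (p i))
  have hu : Continuous u := by fun_prop
  have hu0 (x : sphericalHull p) : u x = 0 ↔ ∃ i, (x : R3) = p i := by
    simp only [u, Finset.prod_eq_zero_iff, Finset.mem_univ, true_and,
      one_sub_inner_eq_zero_iff x.2.1 (hp _)]
  have hfix (x : sphericalHull p) (hx : u x = 0) : F x = x := by
    obtain ⟨i, hi⟩ := (hu0 x).1 hx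
    have hz (j : ι) (hj : j ≠ i) : w x j = 0 :=
      Finset.prod_eq_zero (Finset.mem_erase.2 ⟨hj.symm, Finset.mem_univ i⟩)
        ((one_sub_inner_eq_zero_iff x.2.1 (hp i)).2 hi)
    have hpos : 0 < w x i := by
      obtain ⟨j, hj⟩ := (hw x).2
      by_cases h : j = i
      · exact h ▸ hj
      · exact absurd (hz j h) hj.ne'
    have hsum : ∑ j, w x j • p j = w x i • p i :=
      Fintype.sum_eq_single i fun j hj => by rw [hz j hj, zero_smul]
    refine Subtype.ext ?_
    change ‖∑ i, w x i • p i‖⁻¹ • ∑ i, w x i • p i = x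
    rw [hsum, norm_smul, hp, mul_one, Real.norm_of_nonneg hpos.le, inv_smul_smul₀ hpos.ne', hi]
  have hdesc (x : sphericalHull p) (hx : u x ≠ 0) : u (F x) < u x := by
    have hxp (i : ι) : (x : R3) ≠ p i := fun h => hx ((hu0 x).2 ⟨i, h⟩)
    have hpos : 0 < u x := Finset.prod_pos fun i _ => one_sub_inner_pos x.2.1 (hp i) (hxp i)
    have hsum : ∑ i, w x i • p i = u x • force p x :=
      sum_prod_erase_smul fun i => (one_sub_inner_pos x.2.1 (hp i) (hxp i)).ne'
    have hV : force p x ≠ 0 := by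
      intro h
      exact hwne x (by rw [hsum, h, smul_zero])
    have hV' : 0 < ‖force p x‖ := norm_pos_iff.2 hV
    have hFx : (F x : R3) = ‖force p x‖⁻¹ • force p x := by
      change ‖∑ i, w x i • p i‖⁻¹ • ∑ i, w x i • p i = _
      rw [hsum, norm_smul, Real.norm_of_nonneg hpos.le, smul_smul]
      congr 1
      have := hpos.ne'
      field_simp
    have hVF : force p x = ‖force p x‖ • (F x : R3) := by
      rw [hFx, smul_inv_smul₀ hV'.ne']
    refine prod_lt_of_force hp x.2.1 hxp (F x).2.1 ?_
    have hne : (F x : R3) ≠ x := by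
      intro h
      rw [h] at hVF
      exact hno x x.2.1 hxp x.2.2 _ hVF
    -- `F x` is the direction of the force, so `⟪V, F x - x⟫ = ‖V‖ * (1 - ⟪F x, x⟫)`.
    have h1 := one_sub_inner_pos (F x).2.1 x.2.1 hne
    rw [hVF, real_inner_smul_left, inner_sub_right, real_inner_self_eq_norm_sq, (F x).2.1, one_pow]
    exact mul_pos hV' h1
  have hfin : {x | u x = 0}.Finite := by
    refine Set.Finite.of_finite_image (f := Subtype.val) ((Set.finite_range p).subset ?_)
      Subtype.val_injective.injOn
    rintro _ ⟨x, hx, rfl⟩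
    obtain ⟨i, hi⟩ := (hu0 x).1 hx
    exact ⟨i, hi.symm⟩
  have hsub := subsingleton_of_descent hF hu
    (fun x => Finset.prod_nonneg fun i _ => one_sub_inner_nonneg x.2.1 (hp i)) hdesc hfix hfin
  obtain ⟨i, j, hij⟩ := exists_pair_ne ι
  have hmem (i : ι) : p i ∈ sphericalHull p := ⟨hp i, Submodule.subset_span ⟨i, rfl⟩⟩
  have := hsub (x := ⟨p i, hmem i⟩) ((hu0 _).2 ⟨i, rfl⟩) (y := ⟨p j, hmem j⟩)
    ((hu0 _).2 ⟨j, rfl⟩)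
  exact hij (hinj (congrArg Subtype.val this))

end Cone

/-! ### Hessians -/

/-- On a line, a positive second derivative at a local maximum would also give a local minimum,
hence local constancy and a zero second derivative. -/
theorem hessian_nonpos_of_isLocalMax {f : ℂ → ℝ} {z : ℂ} (hf : ContDiffAt ℝ 2 f z)
    (hmax : IsLocalMax f z) (v : ℂ) : fderiv ℝ (fderiv ℝ f) z v v ≤ 0 := by
  by_contra! hpos
  let γ : ℝ → ℂ := fun t => z + t • v
  have hγ (t : ℝ) : HasDerivAt γ v t := by
    have := ((hasDerivAt_id t).smul_const v).const_add z
    rw [one_smul] at this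
    exact this
  have hγ0 : γ 0 = z := by simp [γ]
  have hγt : Filter.Tendsto γ (nhds 0) (nhds z) := by
    have := (hγ 0).continuousAt.tendsto
    rwa [hγ0] at this
  have hdiff : ∀ᶠ y in nhds z, DifferentiableAt ℝ f y :=
    (hf.eventually (by simp)).mono fun y hy => hy.differentiableAt (by norm_num)
  have hd1 : deriv (fun t => f (γ t)) =ᶠ[nhds 0] fun t => fderiv ℝ f (γ t) v := by
    filter_upwards [hγt.eventually hdiff] with t ht
    exact (ht.hasFDerivAt.comp_hasDerivAt t (hγ t)).deriv
  have hd2 : deriv (deriv fun t => f (γ t)) 0 = fderiv ℝ (fderiv ℝ f) z v v := by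
    rw [hd1.deriv_eq]
    have h1 : DifferentiableAt ℝ (fderiv ℝ f) (γ 0) := by
      rw [hγ0]
      exact (hf.fderiv_right (m := 1) (by norm_num)).differentiableAt (by norm_num)
    have h2 := (h1.hasFDerivAt.comp_hasDerivAt 0 (hγ 0)).clm_apply (hasDerivAt_const 0 v)
    rw [hγ0] at h2
    simpa using h2.deriv
  have hmax' : IsLocalMax (fun t => f (γ t)) 0 := by
    have := hγt.eventually hmax
    simpa only [IsLocalMax, IsMaxFilter, hγ0] using this
  have hcont : ContinuousAt (fun t => f (γ t)) 0 := by
    refine ContinuousAt.comp ?_ (hγ 0).continuousAt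
    rw [hγ0]
    exact hf.continuousAt
  have hmin := isLocalMin_of_deriv_deriv_pos (by rw [hd2]; exact hpos) hmax'.deriv_eq_zero hcont
  have hconst : (fun t => f (γ t)) =ᶠ[nhds 0] fun _ => f (γ 0) := by
    filter_upwards [hmax', hmin] with t h1 h2 using le_antisymm h1 h2
  have h0 : deriv (deriv fun t => f (γ t)) 0 = 0 := by
    rw [hconst.deriv.deriv_eq]
    simp
  rw [← hd2, h0] at hpos
  exact lt_irrefl _ hpos

/-- A negative semidefinite non-degenerate symmetric form is negative definite. -/
theorem neg_of_nonpos_of_nondegenerate {H : ℂ →L[ℝ] ℂ →L[ℝ] ℝ} (hsymm : ∀ v w, H v w = H w v)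
    (hle : ∀ v, H v v ≤ 0) {v : ℂ} (hv : ∃ w, H v w ≠ 0) : H v v < 0 := by
  refine lt_of_le_of_ne (hle v) fun h0 => ?_
  obtain ⟨w, hw⟩ := hv
  have key (t : ℝ) : 2 * t * H v w + t ^ 2 * H w w ≤ 0 := by
    have := hle (v + t • w)
    simp only [map_add, map_smul, add_apply, smul_apply, smul_eq_mul, h0, hsymm w v] at this
    linarith
  have hw2 := hle w
  set A := H v w
  set B := H w w
  have hB : 0 < 1 - B := by linarith
  -- Any small `t` with the sign of `A` would do; `1 - B` is positive even when `B = 0`.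
  have h1 := key (A / (1 - B))
  have e : 2 * (A / (1 - B)) * A + (A / (1 - B)) ^ 2 * B = A ^ 2 * (2 - B) / (1 - B) ^ 2 := by
    field_simp
    ring
  rw [e] at h1
  have : 0 < A ^ 2 * (2 - B) / (1 - B) ^ 2 := by
    have : 0 < 2 - B := by linarith
    positivity
  linarith

theorem hasMorseIndex_two {u : CP1 → ℝ} {q : CP1}
    (hsmooth : ∀ i z, chart i z = q → ContDiffAt ℝ 2 (fun w => u (chart i w)) z)
    (hmax : ∀ i z, chart i z = q → IsLocalMax (fun w => u (chart i w)) z)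
    (hnd : IsNondegenerateAt u q) : HasMorseIndex u q 2 := by
  intro i z hz
  have hneg (v : ℂ) (hv : v ≠ 0) : hessian u i z v v < 0 := by
    refine neg_of_nonpos_of_nondegenerate (fun v w => ?_)
      (hessian_nonpos_of_isLocalMax (hsmooth i z hz) (hmax i z hz)) (hnd i z hz v hv)
    exact (hsmooth i z hz).isSymmSndFDerivAt (by simp) v w
  refine ⟨⟨⊤, by simp, fun v _ hv => hneg v hv⟩, ?_⟩
  rintro d ⟨W, rfl, -⟩
  exact (Submodule.finrank_le W).trans (by simp)

/-- The product of two functions that vanish to second order has vanishing two-jet. -/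
theorem hasFDerivAt_fderiv_mul {A B : ℂ → ℝ} {z : ℂ} (hA : ContDiff ℝ 2 A) (hB : ContDiff ℝ 2 B)
    (hA0 : A z = 0) (hB0 : B z = 0) (hA1 : fderiv ℝ A z = 0) (hB1 : fderiv ℝ B z = 0) :
    fderiv ℝ (fun w => A w * B w) z = 0 ∧
      HasFDerivAt (fderiv ℝ fun w => A w * B w) (0 : ℂ →L[ℝ] ℂ →L[ℝ] ℝ) z := by
  have hAd : Differentiable ℝ A := hA.differentiable (by norm_num)
  have hBd : Differentiable ℝ B := hB.differentiable (by norm_num)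
  have h (y : ℂ) : fderiv ℝ (fun w => A w * B w) y = A y • fderiv ℝ B y + B y • fderiv ℝ A y :=
    fderiv_fun_mul (hAd y) (hBd y)
  have hA2 : DifferentiableAt ℝ (fderiv ℝ A) z :=
    (hA.fderiv_right (m := 1) (by norm_num)).differentiable (by norm_num) z
  have hB2 : DifferentiableAt ℝ (fderiv ℝ B) z :=
    (hB.fderiv_right (m := 1) (by norm_num)).differentiable (by norm_num) z
  refine ⟨by rw [h, hA1, hB1]; simp, ?_⟩
  rw [funext h]
  have := ((hAd z).hasFDerivAt.smul hB2.hasFDerivAt).add ((hBd z).hasFDerivAt.smul hA2.hasFDerivAt)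
  convert! this using 1
  ext v w
  simp [hA0, hB0, hA1, hB1]

/-! ### Smoothness of the norm and multiple zeros -/

namespace HolSection

variable {n : ℕ}

theorem normSq_chart (s : HolSection n) (k : Fin 2) (z : ℂ) :
    s.normSq (chart k z) = ‖s.coeff k z‖ ^ 2 / (1 + ‖z‖ ^ 2) ^ n := by
  rw [chart, normSq_mk, pow_mul, norm_chartVec_sq, coeff]

theorem contDiff_coeff (s : HolSection n) (k : Fin 2) : ContDiff ℝ 2 (s.coeff k) :=
  ((s.differentiable_coeff k).contDiff (n := 2)).restrict_scalars ℝ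

theorem contDiff_metric (n : ℕ) : ContDiff ℝ 2 fun z : ℂ => ((1 + ‖z‖ ^ 2) ^ n)⁻¹ :=
  ((contDiff_const.add (contDiff_norm_sq ℝ)).pow n).inv fun z => by positivity

theorem contDiffAt_logNormSq (s : HolSection n) {k : Fin 2} {z : ℂ} (hz : s.coeff k z ≠ 0) :
    ContDiffAt ℝ 2 (fun w => s.logNormSq (chart k w)) z := by
  simp only [logNormSq, normSq_chart]
  refine ContDiffAt.log ?_ (by positivity)
  exact (((s.contDiff_coeff k).norm_sq ℝ).mul (contDiff_metric n)).contDiffAt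

theorem isLocalMax_logNormSq_chart (s : HolSection n) {k : Fin 2} {z : ℂ}
    (hz : s.coeff k z ≠ 0) (hmax : ∀ q, s.normSq q ≤ s.normSq (chart k z)) :
    IsLocalMax (fun w => s.logNormSq (chart k w)) z := by
  -- Zeros of `s` must be kept away: there `Real.log 0 = 0` could exceed the maximum.
  filter_upwards [(s.differentiable_coeff k).continuous.continuousAt.eventually_ne hz] with w hw
  refine Real.log_le_log ?_ (hmax _)
  rw [normSq_chart]
  positivity

/-- A multiple zero is a degenerate critical point of `|s|²`. -/
theorem degenerate_of_deriv_eq_zero (s : HolSection n) {k : Fin 2} {z : ℂ}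
    (h0 : s.coeff k z = 0) (h1 : deriv (s.coeff k) z = 0) :
    fderiv ℝ (fun w => s.normSq (chart k w)) z = 0 ∧ hessian s.normSq k z = 0 := by
  have hf : HasFDerivAt (s.coeff k) (0 : ℂ →L[ℝ] ℂ) z := by
    have := (s.differentiable_coeff k z).hasDerivAt
    rw [h1] at this
    convert! this.hasFDerivAt.restrictScalars ℝ using 1
    ext
    simp
  -- Used for the real and imaginary parts of `|f|² = (Re f)² + (Im f)²`; the metric weight is
  -- absorbed into the second factor.
  have key (L : ℂ →L[ℝ] ℝ) :
      fderiv ℝ (fun w => L (s.coeff k w) * (L (s.coeff k w) * ((1 + ‖w‖ ^ 2) ^ n)⁻¹)) z = 0 ∧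
      HasFDerivAt (fderiv ℝ fun w => L (s.coeff k w) * (L (s.coeff k w) *
        ((1 + ‖w‖ ^ 2) ^ n)⁻¹)) (0 : ℂ →L[ℝ] ℂ →L[ℝ] ℝ) z := by
    have hL : HasFDerivAt (fun w => L (s.coeff k w)) (0 : ℂ →L[ℝ] ℝ) z := by
      have := L.hasFDerivAt.comp z hf
      rw [ContinuousLinearMap.comp_zero] at this
      exact this
    have hLc : ContDiff ℝ 2 fun w => L (s.coeff k w) := L.contDiff.comp (s.contDiff_coeff k)
    refine hasFDerivAt_fderiv_mul hLc (hLc.mul (contDiff_metric n)) (by simp [h0]) (by simp [h0])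
      hL.fderiv ?_
    rw [fderiv_fun_mul hL.differentiableAt
      ((contDiff_metric n).differentiable (by norm_num) z), hL.fderiv]
    simp [h0]
  have hsplit : (fun w => s.normSq (chart k w)) = fun w =>
      Complex.reCLM (s.coeff k w) * (Complex.reCLM (s.coeff k w) * ((1 + ‖w‖ ^ 2) ^ n)⁻¹) +
      Complex.imCLM (s.coeff k w) * (Complex.imCLM (s.coeff k w) * ((1 + ‖w‖ ^ 2) ^ n)⁻¹) := by
    funext w
    rw [normSq_chart, ← Complex.normSq_eq_norm_sq, Complex.normSq_apply]
    simp only [Complex.reCLM_apply, Complex.imCLM_apply]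
    ring
  have hd (L : ℂ →L[ℝ] ℝ) : Differentiable ℝ
      fun w => L (s.coeff k w) * (L (s.coeff k w) * ((1 + ‖w‖ ^ 2) ^ n)⁻¹) := by
    have hLc : ContDiff ℝ 2 fun w => L (s.coeff k w) := L.contDiff.comp (s.contDiff_coeff k)
    exact (hLc.mul (hLc.mul (contDiff_metric n))).differentiable (by norm_num)
  have hfd := fun w => fderiv_fun_add (hd Complex.reCLM w) (hd Complex.imCLM w)
  constructor
  · rw [hsplit, hfd, (key _).1, (key _).1, add_zero]
  · rw [hessian, hsplit, funext hfd]
    have := ((key Complex.reCLM).2.add (key Complex.imCLM).2).fderiv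
    rw [add_zero] at this
    exact this

/-- At a zero `∇ s` reduces to the derivative of the coefficient, so a critical zero is a multiple
one. -/
theorem not_mem_criticalSet_of_mem_zeros {s : HolSection n}
    (hnd : ∀ p, IsCriticalPt s.normSq p → IsNondegenerateAt s.normSq p) {q : CP1}
    (hq : q ∈ s.zeros) : q ∉ s.criticalSet := by
  intro hcrit
  have hdeg (k : Fin 2) (z : ℂ) (hz : chart k z = q) :
      fderiv ℝ (fun w => s.normSq (chart k w)) z = 0 ∧ hessian s.normSq k z = 0 := by
    have h0 : s.coeff k z = 0 := mem_zeros_chart_iff.1 (hz ▸ hq)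
    refine s.degenerate_of_deriv_eq_zero h0 ?_
    have := hcrit k z hz 1
    rwa [covDeriv_eq, h0, zero_mul, sub_zero, mul_one] at this
  obtain ⟨k, z, hz⟩ := chart_surjective q
  obtain ⟨w, hw⟩ := hnd q (fun k z hz => (hdeg k z hz).1) k z hz 1 one_ne_zero
  rw [(hdeg k z hz).2] at hw
  simp at hw

/-- Each term of the product rule omits one factor, so one of the two vanishing factors always
remains. -/
theorem Factors.mem_criticalSet_of_root_eq {s : HolSection n} {C : ℂ} {b : Fin n → C2}
    (hf : s.Factors C b) {i j : Fin n} (hij : i ≠ j) (h : root b i = root b j) {q : CP1}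
    (hq : pt q = root b i) : q ∈ s.criticalSet := by
  rintro k z rfl h'
  have hz (l : Fin n) (hl : pt (chart k z) = root b l) : inner ℂ (b l) (chartVec k z) = 0 := by
    have h1 := hf.one_sub_inner_root l (chartVec_ne_zero k z)
    rw [pt_chart] at hl
    rw [(one_sub_inner_eq_zero_iff (norm_bloch (chartVec_ne_zero k z)) (hf.norm_root l)).2 hl]
      at h1
    simpa [hf.ne_zero l, chartVec_ne_zero k z] using h1.symm
  have hi := hz i hq
  have hj := hz j (hq.trans h)
  rw [covDeriv_eq, mem_zeros_chart_iff.1 (hf.mem_zeros_iff.2 ⟨i, hq⟩),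
    (hf.hasDerivAt_coeff k z).deriv, Finset.sum_eq_zero, mul_zero, zero_mul, sub_zero, zero_mul]
  intro l _
  by_cases hl : l = i
  · rw [Finset.prod_eq_zero (Finset.mem_erase.2 ⟨hl ▸ hij.symm, Finset.mem_univ j⟩) hj, zero_mul]
  · rw [Finset.prod_eq_zero (Finset.mem_erase.2 ⟨Ne.symm hl, Finset.mem_univ i⟩) hi, zero_mul]

end HolSection

/-! ### The position of the critical points -/

namespace HolSection

variable {n : ℕ} {s : HolSection n} {C : ℂ} {b : Fin n → C2} {c : CP1}

theorem Factors.inner_root_pos (hf : s.Factors C b) (hc : s.zeros ⊆ openHemisphere c)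
    (i : Fin n) : 0 < inner ℝ (pt c) (root b i) := by
  obtain ⟨q, hq⟩ := pt_surjective (hf.norm_root i)
  rw [← hq]
  exact mem_openHemisphere_iff.1 (hc (hf.mem_zeros_iff.2 ⟨i, hq⟩))

theorem Factors.mem_hull_iff (hf : s.Factors C b) (hc : s.zeros ⊆ openHemisphere c) {q : CP1} :
    q ∈ s.hull ↔ pt q ∈ coneSpan (root b) :=
  mem_geodHull_iff hf.norm_root (hf.inner_root_pos hc) fun _ => hf.mem_zeros_iff

theorem Factors.mem_opposite_hull_iff (hf : s.Factors C b) (hc : s.zeros ⊆ openHemisphere c)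
    {q : CP1} : q ∈ opposite s.hull ↔ pt q ∈ coneSpan (-root b) :=
  mem_opposite_coneSpan fun _ => hf.mem_hull_iff hc

theorem Factors.zeros_subset_hull (hf : s.Factors C b) (hc : s.zeros ⊆ openHemisphere c) :
    s.zeros ⊆ s.hull := by
  intro q hq
  obtain ⟨i, hi⟩ := hf.mem_zeros_iff.1 hq
  exact (hf.mem_hull_iff hc).2 (hi ▸ Submodule.subset_span ⟨i, rfl⟩)

theorem Factors.inner_pos_of_mem_hull (hf : s.Factors C b) (hc : s.zeros ⊆ openHemisphere c)
    {q : CP1} (hq : q ∈ s.hull) : 0 < inner ℝ (pt c) (pt q) :=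
  inner_pos_of_mem_coneSpan (hf.inner_root_pos hc) ((hf.mem_hull_iff hc).1 hq) (pt_ne_zero q)

theorem Factors.inner_neg_of_mem_opposite_hull (hf : s.Factors C b)
    (hc : s.zeros ⊆ openHemisphere c) {q : CP1} (hq : q ∈ opposite s.hull) :
    inner ℝ (pt c) (pt q) < 0 := by
  have h := coneSpan_neg.1 ((hf.mem_opposite_hull_iff hc).1 hq)
  have := inner_pos_of_mem_coneSpan (hf.inner_root_pos hc) h (neg_ne_zero.2 (pt_ne_zero q))
  rw [inner_neg_right] at this
  linarith

theorem Factors.pos_combination_of_critical (hf : s.Factors C b)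
    (hc : s.zeros ⊆ openHemisphere c) (hn : 2 ≤ n) {q : CP1} (hq : q ∈ s.criticalSet)
    (hqz : q ∉ s.zeros) :
    (0 < inner ℝ (pt c) (pt q) ∧
      ∃ t : Fin n → ℝ, (∀ i, 0 < t i) ∧ pt q = ∑ i, t i • root b i) ∨
    (inner ℝ (pt c) (pt q) < 0 ∧
      ∃ t : Fin n → ℝ, (∀ i, 0 < t i) ∧ pt q = ∑ i, t i • (-root b) i) := by
  have : Nonempty (Fin n) := ⟨⟨0, by omega⟩⟩
  obtain ⟨a, ha⟩ := (hf.mem_criticalSet_iff hqz).1 hq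
  exact pos_combination_of_force_eq hf.norm_root (hf.inner_root_pos hc) (norm_pt q)
    (fun i hi => hqz (hf.mem_zeros_iff.2 ⟨i, hi⟩)) ha

theorem Factors.criticalSet_subset (hf : s.Factors C b) (hc : s.zeros ⊆ openHemisphere c)
    (hn : 2 ≤ n) : s.criticalSet ⊆ s.hull ∪ opposite s.hull := by
  intro q hq
  by_cases hqz : q ∈ s.zeros
  · exact Or.inl (hf.zeros_subset_hull hc hqz)
  rcases hf.pos_combination_of_critical hc hn hq hqz with ⟨-, t, ht, e⟩ | ⟨-, t, ht, e⟩
  · exact Or.inl ((hf.mem_hull_iff hc).2 (mem_coneSpan_iff.2 ⟨t, fun i => (ht i).le, e.symm⟩))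
  · exact Or.inr ((hf.mem_opposite_hull_iff hc).2
      (mem_coneSpan_iff.2 ⟨t, fun i => (ht i).le, e.symm⟩))

/-- The sign of `⟪c, ·⟫` excludes zeros from `P_∞` and selects the combination of the `-p i`, whose
coefficients are strictly positive. -/
theorem Factors.critical_opposite_subset_interior (hf : s.Factors C b)
    (hc : s.zeros ⊆ openHemisphere c) (hn : 2 ≤ n) :
    s.criticalSet ∩ opposite s.hull ⊆ geodInterior (opposite s.hull) := by
  rintro q ⟨hq, hqo⟩
  have hneg := hf.inner_neg_of_mem_opposite_hull hc hqo
  have hqz : q ∉ s.zeros := fun h =>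
    lt_asymm hneg (hf.inner_pos_of_mem_hull hc (hf.zeros_subset_hull hc h))
  rcases hf.pos_combination_of_critical hc hn hq hqz with ⟨h, -⟩ | ⟨-, t, ht, e⟩
  · exact absurd h hneg.not_gt
  · exact mem_geodInterior (fun _ => hf.mem_opposite_hull_iff hc) ht e

theorem Factors.critical_hull_subset_interior (hf : s.Factors C b)
    (hc : s.zeros ⊆ openHemisphere c) (hn : 2 ≤ n) (hz : ∀ q ∈ s.zeros, q ∉ s.criticalSet) :
    s.criticalSet ∩ s.hull ⊆ geodInterior s.hull := by
  rintro q ⟨hq, hqh⟩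
  have hpos := hf.inner_pos_of_mem_hull hc hqh
  rcases hf.pos_combination_of_critical hc hn hq (fun h => hz q h hq) with
    ⟨-, t, ht, e⟩ | ⟨h, -⟩
  · exact mem_geodInterior (fun _ => hf.mem_hull_iff hc) ht e
  · exact absurd h hpos.not_gt

theorem Factors.critical_hull_nonempty (hf : s.Factors C b)
    (hc : s.zeros ⊆ openHemisphere c) (hn : 2 ≤ n) (hz : ∀ q ∈ s.zeros, q ∉ s.criticalSet) :
    (s.criticalSet ∩ s.hull).Nonempty := by
  have : Nontrivial (Fin n) := Fin.nontrivial_iff_two_le.2 hn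
  have hinj : Function.Injective (root b) := by
    intro i j hij
    by_contra hne
    obtain ⟨q, hq⟩ := pt_surjective (hf.norm_root i)
    exact hz q (hf.mem_zeros_iff.2 ⟨i, hq⟩) (hf.mem_criticalSet_of_root_eq hne hij hq)
  obtain ⟨x, hx, hxp, hxc, ha⟩ :=
    exists_equilibrium_mem_coneSpan hf.norm_root hinj (hf.inner_root_pos hc)
  obtain ⟨q, rfl⟩ := pt_surjective hx
  have hqz : q ∉ s.zeros := fun h => by
    obtain ⟨i, hi⟩ := hf.mem_zeros_iff.1 h
    exact hxp i hi
  exact ⟨q, (hf.mem_criticalSet_iff hqz).2 ha, (hf.mem_hull_iff hc).2 hxc⟩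

/-- The maximum of `|s|²` is a critical point opposite to the hull of the zeros. -/
theorem Factors.exists_max (hf : s.Factors C b) (hc : s.zeros ⊆ openHemisphere c)
    (hn : 2 ≤ n) :
    ∃ q ∈ s.criticalSet ∩ opposite s.hull, q ∉ s.zeros ∧ ∀ r, s.normSq r ≤ s.normSq q := by
  have : Nonempty (Fin n) := ⟨⟨0, by omega⟩⟩
  obtain ⟨x, hx, hxp, hcx, ha, hmax⟩ :=
    exists_max_prod hf.norm_root (norm_pt c) (hf.inner_root_pos hc)
  obtain ⟨q, rfl⟩ := pt_surjective hx
  have hqz : q ∉ s.zeros := fun h => by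
    obtain ⟨i, hi⟩ := hf.mem_zeros_iff.1 h
    exact hxp i hi
  have hcrit := (hf.mem_criticalSet_iff hqz).2 ha
  refine ⟨q, ⟨hcrit, ?_⟩, hqz, fun r => ?_⟩
  · rcases hf.criticalSet_subset hc hn hcrit with h | h
    · exact absurd (hf.inner_pos_of_mem_hull hc h) (not_lt.2 hcx)
    · exact h
  · obtain ⟨K, hK, h⟩ := hf.normSq_eq
    rw [h, h]
    exact mul_le_mul_of_nonneg_left (hmax _ (norm_pt r)) hK.le

theorem Factors.isLocalMaxAt_logNormSq (hf : s.Factors C b) {q : CP1} (hq : q ∉ s.zeros)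
    (hmax : ∀ r, s.normSq r ≤ s.normSq q) : IsLocalMaxAt s.logNormSq q := by
  have hne (i : Fin n) : pt q ≠ root b i := fun h => hq (hf.mem_zeros_iff.2 ⟨i, h⟩)
  have hcont : Continuous fun x : R3 => ∏ i, (1 - inner ℝ x (root b i)) := by fun_prop
  have hpos : 0 < ∏ i, (1 - inner ℝ (pt q) (root b i)) :=
    Finset.prod_pos fun i _ => one_sub_inner_pos (norm_pt q) (hf.norm_root i) (hne i)
  -- A ball free of zeros, again because of the default value `Real.log 0 = 0`.
  obtain ⟨ε, hε, h⟩ := Metric.eventually_nhds_iff.1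
    (hcont.continuousAt.eventually (lt_mem_nhds hpos))
  refine ⟨ε / 2, by positivity, fun r hr => Real.log_le_log ?_ (hmax r)⟩
  obtain ⟨K, hK, e⟩ := hf.normSq_eq
  rw [e]
  refine mul_pos hK (h ?_)
  rw [dist_comm, dist_eq_norm]
  linarith [norm_pt_sub_le q r]

theorem hasMorseIndex_logNormSq {q : CP1} (hq : q ∉ s.zeros)
    (hmax : ∀ r, s.normSq r ≤ s.normSq q) (hnd : IsNondegenerateAt s.logNormSq q) :
    HasMorseIndex s.logNormSq q 2 := by
  refine hasMorseIndex_two ?_ ?_ hnd <;> rintro k z rfl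
  · exact s.contDiffAt_logNormSq fun h => hq (mem_zeros_chart_iff.2 h)
  · exact s.isLocalMax_logNormSq_chart (fun h => hq (mem_zeros_chart_iff.2 h)) hmax

end HolSection

end SphericalGL

end

theorem theorem1p3 (n : ℕ) (hn : 2 ≤ n) (s : SphericalGL.HolSection n) (hs : s.IsNonzero)
    (hZ : ∃ c : SphericalGL.CP1, s.zeros ⊆ SphericalGL.openHemisphere c) :
    -- every critical point lies in the hull `P` or in its opposite `P_∞`
    s.criticalSet =
        (s.criticalSet ∩ s.hull) ∪ (s.criticalSet ∩ SphericalGL.opposite s.hull) ∧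
    -- `P_∞` contains a critical point
    (s.criticalSet ∩ SphericalGL.opposite s.hull).Nonempty ∧
    -- if `P` is not a point, the critical points in `P_∞` are in its interior
    ((¬ ∃ p, s.hull = {p}) →
      s.criticalSet ∩ SphericalGL.opposite s.hull ⊆
        SphericalGL.geodInterior (SphericalGL.opposite s.hull)) ∧
    -- some critical point in `P_∞` is a local maximum of `log |s|²`, of index 2 if non-degenerate
    (∃ q ∈ s.criticalSet ∩ SphericalGL.opposite s.hull,
      q ∉ s.zeros ∧ SphericalGL.IsLocalMaxAt s.logNormSq q ∧
      (SphericalGL.IsNondegenerateAt s.logNormSq q →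
        SphericalGL.HasMorseIndex s.logNormSq q 2)) ∧
    -- if `|s|²` has only non-degenerate critical points, `P` contains critical points of `s`,
    -- all of them in its interior
    ((∀ p, SphericalGL.IsCriticalPt s.normSq p → SphericalGL.IsNondegenerateAt s.normSq p) →
      (s.criticalSet ∩ s.hull).Nonempty ∧
      s.criticalSet ∩ s.hull ⊆ SphericalGL.geodInterior s.hull) := by
  obtain ⟨c, hc⟩ := hZ
  obtain ⟨C, b, hC, hb, hprod⟩ := s.exists_factorization hs
  have hf : s.Factors C b := ⟨hC, hb, hprod⟩
  obtain ⟨q, hq, hqz, hmax⟩ := hf.exists_max hc hn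
  refine ⟨?_, ⟨q, hq⟩, fun _ => hf.critical_opposite_subset_interior hc hn,
    ⟨q, hq, hqz, hf.isLocalMaxAt_logNormSq hqz hmax,
      SphericalGL.HolSection.hasMorseIndex_logNormSq hqz hmax⟩, fun hnd => ?_⟩
  · rw [← Set.inter_union_distrib_left]
    exact (Set.inter_eq_left.2 (hf.criticalSet_subset hc hn)).symm
  · have hz (p : SphericalGL.CP1) (hp : p ∈ s.zeros) : p ∉ s.criticalSet :=
      SphericalGL.HolSection.not_mem_criticalSet_of_mem_zeros hnd hp
    exact ⟨hf.critical_hull_nonempty hc hn hz, hf.critical_hull_subset_interior hc hn hz⟩
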